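/- Let $p\in(0,1)$ be a constant, and let $G_p\in\mathcal{G}_{n,p}$ be the random simple graph on $n$ vertices in which each of the $\binom n2$ possible edges is present independently with probability $p$. For a graph $G$ with vertex set $\{1,\dots,n\}$ let $D(i,j)$ be the distance between $i$ and $j$ in $G$. The Harary matrix $RD(G)$ is the real symmetric $n\times n$ matrix with entries $RD(G)(i,j)=1/D(i,j)$ for $i\neq j$ (with $1/\infty=0$ if $i$ and $j$ are in different components) and $RD(G)(i,i)=0$. The Harary energy is $HE(G)=\sum_{i=1}^n|\lambda_i|$, where $\lambda_1,\dots,\lambda_n$ are the eigenvalues of $RD(G)$ counted with multiplicity. Then $$HE(G_p)=\Bigl(\frac{4}{3\pi}\sqrt{p(1-p)}+o(1)\Bigr)n^{3/2}\quad\text{with probability tending to }1\text{ as }n\to\infty,$$ that is, for every $\varepsilon>0$, $$\lim_{n\to\infty}\Pr\Bigl[\,\Bigl|HE(G_p)-\frac{4}{3\pi}\sqrt{p(1-p)}\;n^{3/2}\Bigr|\le\varepsilon\,n^{3/2}\Bigr]=1 .$$ -/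

import Mathlib

open Filter Topology

/-- The Harary matrix `RD(G)` of a graph on a finite vertex set: the off-diagonal entries are the
reciprocal distances `1 / D(i, j)` and the diagonal entries are `0`. If `i` and `j` lie in different
components then `G.dist i j = 0` by Mathlib's convention, so that the entry is `1 / 0 = 0`, which is
the usual convention `1 / ∞ = 0`. -/
noncomputable def hararyMatrix {V : Type*} [DecidableEq V] (G : SimpleGraph V) : Matrix V V ℝ :=
  Matrix.of fun i j => if i = j then 0 else 1 / (G.dist i j : ℝ)

theorem hararyMatrix_isHermitian {V : Type*} [DecidableEq V] (G : SimpleGraph V) :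
    (hararyMatrix G).IsHermitian := by
  ext i j
  simp [hararyMatrix, SimpleGraph.dist_comm, eq_comm]

/-- The energy of a real symmetric matrix: the sum of the absolute values of its eigenvalues,
counted with multiplicity. -/
noncomputable def matrixEnergy {V : Type*} [Fintype V] [DecidableEq V] {A : Matrix V V ℝ}
    (hA : A.IsHermitian) : ℝ :=
  ∑ i, |hA.eigenvalues i|

/-- The Harary energy `HE(G)`, that is, the energy of the Harary matrix of `G`. -/
noncomputable def hararyEnergy {V : Type*} [Fintype V] [DecidableEq V] (G : SimpleGraph V) : ℝ :=
  matrixEnergy (hararyMatrix_isHermitian G)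

/-! With high probability every two vertices have a common neighbour: a given pair fails with
probability `(1 - p²) ^ (n - 2)`, and a union bound over pairs suffices. All distances are then `1`
or `2`, so the off-diagonal entries of `RD(G)` are `(1 + A i j) / 2` with `A` the adjacency matrix.
In terms of the centred, normalized matrix `X` (`normalizedAdj`) this reads `RD(G) = (√n / 2) X +
((1 + p) / 2) (J - 1)`. The last summand has trace norm at most `2 n = o(n ^ (3/2))`, so by
`abs_matrixEnergy_sub_le` only the energy of `X` matters.

With `v = p (1 - p)`, the energy of `X` divided by `n` tends to the first absolute moment `8 √v / (3
π)` of the semicircle law of variance `v`. Coulson's formula `|λ| π / 2 = ∫₀^∞ λ² / (λ² + y²) dy`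
writes the energy as an integral of `1 - y Im s(i y)`, where `s` is the normalized trace of the
resolvent. Hence only the imaginary axis is needed, and no convergence of spectral measures has to
be discussed.

For fixed `y > 0`, `s` nearly solves `1 + i y s + v s² = 0`: resampling one edge at a time is a
discrete integration by parts, and it bounds the mean square of the defect by a constant times `n ^
(-1/2)` (`graphExp_norm_sq_selfConsistentDefect_le`). Since `Im s ≥ 0`, the defect controls the
distance to the semicircle value (`abs_one_sub_mul_im_sub_semicircleCoulson_le`). Dominated
convergence in `y` then gives convergence of the energy in mean, and Markov's inequality gives the
theorem. -/

/-! ### Energy as a trace norm, and its stability under perturbation. -/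

section Energy

variable {V : Type*} [Fintype V] [DecidableEq V]

open scoped Matrix

/-- In any orthonormal basis, the absolute values of the diagonal entries of a real symmetric
matrix sum to at most its energy. -/
theorem sum_abs_quadForm_le_matrixEnergy {B : Matrix V V ℝ} (hB : B.IsHermitian)
    (b : OrthonormalBasis V ℝ (EuclideanSpace ℝ V)) :
    ∑ i, |(b i).ofLp ⬝ᵥ B *ᵥ (b i).ofLp| ≤ matrixEnergy hB := by
  have key : ∀ x : EuclideanSpace ℝ V, x.ofLp ⬝ᵥ B *ᵥ x.ofLp
      = ∑ j, hB.eigenvalues j * ‖inner ℝ (hB.eigenvectorBasis j) x‖ ^ 2 := by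
    intro x
    have h1 : x.ofLp ⬝ᵥ B *ᵥ x.ofLp = inner ℝ x (WithLp.toLp 2 (B *ᵥ x.ofLp)) := by
      rw [EuclideanSpace.inner_eq_star_dotProduct, dotProduct_comm]; simp
    rw [h1, ← hB.eigenvectorBasis.sum_inner_mul_inner]
    refine Finset.sum_congr rfl fun j _ => ?_
    have h2 : inner ℝ (hB.eigenvectorBasis j) (WithLp.toLp 2 (B *ᵥ x.ofLp))
        = hB.eigenvalues j * inner ℝ (hB.eigenvectorBasis j) x := by
      rw [EuclideanSpace.inner_eq_star_dotProduct, EuclideanSpace.inner_eq_star_dotProduct]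
      have h3 := hB.mulVec_eigenvectorBasis j
      have hBt : Bᵀ = B := by simpa using hB.eq
      simp only [star_trivial]
      rw [dotProduct_comm, Matrix.dotProduct_mulVec, ← Matrix.mulVec_transpose, hBt, h3,
        smul_dotProduct, dotProduct_comm, smul_eq_mul]
    rw [h2, real_inner_comm, Real.norm_eq_abs, sq_abs]
    ring
  calc ∑ i, |(b i).ofLp ⬝ᵥ B *ᵥ (b i).ofLp|
      ≤ ∑ i, ∑ j, |hB.eigenvalues j| * ‖inner ℝ (hB.eigenvectorBasis j) (b i)‖ ^ 2 := by
        refine Finset.sum_le_sum fun i _ => ?_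
        rw [key]
        refine (Finset.abs_sum_le_sum_abs _ _).trans (le_of_eq ?_)
        refine Finset.sum_congr rfl fun j _ => ?_
        rw [abs_mul, abs_of_nonneg (sq_nonneg ‖_‖)]
    _ = matrixEnergy hB := by
        rw [Finset.sum_comm]
        refine Finset.sum_congr rfl fun j _ => ?_
        rw [← Finset.mul_sum, b.sum_sq_norm_inner_left, hB.eigenvectorBasis.norm_eq_one]
        simp

theorem matrixEnergy_eq_sum_abs_quadForm {A : Matrix V V ℝ} (hA : A.IsHermitian) :
    matrixEnergy hA = ∑ i, |(hA.eigenvectorBasis i).ofLp ⬝ᵥ A *ᵥ (hA.eigenvectorBasis i).ofLp| := by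
  refine Finset.sum_congr rfl fun i _ => ?_
  rw [hA.eigenvalues_eq]
  simp

/-- Perturbation bound for the energy, when `A - c B` is small in trace norm. -/
theorem abs_matrixEnergy_sub_le {A B : Matrix V V ℝ} (hA : A.IsHermitian) (hB : B.IsHermitian)
    {c K : ℝ} (hc : 0 ≤ c)
    (h : ∀ b : OrthonormalBasis V ℝ (EuclideanSpace ℝ V),
      ∑ i, |(b i).ofLp ⬝ᵥ (A - c • B) *ᵥ (b i).ofLp| ≤ K) :
    |matrixEnergy hA - c * matrixEnergy hB| ≤ K := by
  have split : ∀ x : V → ℝ, x ⬝ᵥ (A - c • B) *ᵥ x = x ⬝ᵥ A *ᵥ x - c * (x ⬝ᵥ B *ᵥ x) := by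
    intro x
    rw [Matrix.sub_mulVec, dotProduct_sub, Matrix.smul_mulVec, dotProduct_smul, smul_eq_mul]
  have aux : ∀ b : OrthonormalBasis V ℝ (EuclideanSpace ℝ V),
      |(∑ i, |(b i).ofLp ⬝ᵥ A *ᵥ (b i).ofLp|) - c * (∑ i, |(b i).ofLp ⬝ᵥ B *ᵥ (b i).ofLp|)| ≤ K := by
    intro b
    refine le_trans ?_ (h b)
    rw [Finset.mul_sum, ← Finset.sum_sub_distrib]
    refine (Finset.abs_sum_le_sum_abs _ _).trans (Finset.sum_le_sum fun i _ => ?_)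
    rw [split, ← abs_of_nonneg hc, ← abs_mul, abs_of_nonneg hc]
    exact abs_abs_sub_abs_le_abs_sub _ _
  -- In the eigenbasis of `A` the first sum equals the energy of `A` and the second is at most that
  -- of `B`; the eigenbasis of `B` reverses the roles. This yields the two one-sided bounds.
  have hAb := abs_le.1 (aux hA.eigenvectorBasis)
  have hBb := abs_le.1 (aux hB.eigenvectorBasis)
  rw [← matrixEnergy_eq_sum_abs_quadForm hA] at hAb
  rw [← matrixEnergy_eq_sum_abs_quadForm hB] at hBb
  have h1 := mul_le_mul_of_nonneg_left
    (sum_abs_quadForm_le_matrixEnergy hB hA.eigenvectorBasis) hc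
  have h2 := sum_abs_quadForm_le_matrixEnergy hA hB.eigenvectorBasis
  rw [abs_le]
  constructor <;> linarith [hAb.1, hAb.2, hBb.1, hBb.2]

/-- The sum of `|⟨b i, c (J - 1) b i⟩|` over an orthonormal basis is at most `2 |c| n`. -/
theorem sum_abs_quadForm_allOnes_sub_one_le (c : ℝ)
    (b : OrthonormalBasis V ℝ (EuclideanSpace ℝ V)) :
    ∑ i, |(b i).ofLp ⬝ᵥ (c • (Matrix.of (fun _ _ => 1) - 1 : Matrix V V ℝ)) *ᵥ (b i).ofLp|
      ≤ 2 * |c| * Fintype.card V := by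
  set e : EuclideanSpace ℝ V := WithLp.toLp 2 fun _ => 1 with he
  have h1 : ∀ i, (b i).ofLp ⬝ᵥ (c • (Matrix.of (fun _ _ => 1) - 1 : Matrix V V ℝ)) *ᵥ (b i).ofLp
      = c * (‖inner ℝ (b i) e‖ ^ 2 - 1) := by
    intro i
    have hn : (b i).ofLp ⬝ᵥ (b i).ofLp = 1 := by
      have := b.norm_eq_one i
      have h2 : inner ℝ (b i) (b i) = (1 : ℝ) := by rw [real_inner_self_eq_norm_sq, this]; norm_num
      rw [EuclideanSpace.inner_eq_star_dotProduct] at h2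
      simpa using h2
    have hJ : (Matrix.of (fun _ _ => (1 : ℝ)) : Matrix V V ℝ) *ᵥ (b i).ofLp
        = fun _ => inner ℝ (b i) e := by
      ext k
      rw [EuclideanSpace.inner_eq_star_dotProduct]
      simp [Matrix.mulVec, he]
    have hK : (b i).ofLp ⬝ᵥ (fun _ => inner ℝ (b i) e) = (inner ℝ (b i) e) ^ 2 := by
      have hs : inner ℝ (b i) e = ∑ k, (b i).ofLp k := by
        rw [EuclideanSpace.inner_eq_star_dotProduct]
        simp [he, dotProduct]
      rw [sq, hs]
      simp only [dotProduct]
      rw [← Finset.sum_mul]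
    rw [Matrix.smul_mulVec, dotProduct_smul, Matrix.sub_mulVec, dotProduct_sub, Matrix.one_mulVec,
      hn, hJ, hK, Real.norm_eq_abs, sq_abs, smul_eq_mul]
  -- Parseval for the all-ones vector, whose squared norm is `n`.
  have h2 : ∑ i, ‖inner ℝ (b i) e‖ ^ 2 = Fintype.card V := by
    rw [b.sum_sq_norm_inner_right, EuclideanSpace.norm_sq_eq]
    simp [he]
  calc _ ≤ ∑ i, |c| * (‖inner ℝ (b i) e‖ ^ 2 + 1) := by
        refine Finset.sum_le_sum fun i _ => ?_
        rw [h1, abs_mul]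
        refine mul_le_mul_of_nonneg_left ?_ (abs_nonneg c)
        rw [abs_le]; constructor <;> nlinarith [sq_nonneg ‖inner ℝ (b i) e‖]
    _ = _ := by
        rw [← Finset.mul_sum, Finset.sum_add_distrib, h2]; simp; ring

end Energy

/-! ### The resolvent on the imaginary axis. -/

section Resolvent

variable {V : Type*} [Fintype V] [DecidableEq V]

open scoped Matrix.Norms.L2Operator Matrix

/-- The resolvent `(X - i y)⁻¹` of a real matrix at the point `i y` of the imaginary axis. -/
noncomputable def imResolvent (X : Matrix V V ℝ) (y : ℝ) : Matrix V V ℂ :=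
  (X.map Complex.ofReal - ((y : ℂ) * Complex.I) • (1 : Matrix V V ℂ))⁻¹

theorem ofReal_sub_mul_I_ne_zero (x : ℝ) {y : ℝ} (hy : 0 < y) :
    (x : ℂ) - (y : ℂ) * Complex.I ≠ 0 := by
  intro h
  have := congrArg Complex.im h
  simp at this
  exact hy.ne' this

/-- A real orthogonal eigenvector matrix stays unitary over `ℂ` and diagonalizes the resolvent; no
eigenvalue equals `i y`, so the matrix inverse is a genuine one. Trace and norm bounds are read off
from this form. -/
theorem imResolvent_spectral {X : Matrix V V ℝ} (hX : X.IsHermitian) {y : ℝ} (hy : 0 < y) :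
    ∃ U ∈ Matrix.unitaryGroup V ℂ,
      (X.map Complex.ofReal - ((y : ℂ) * Complex.I) • (1 : Matrix V V ℂ)) * imResolvent X y = 1 ∧
      imResolvent X y
        = U * Matrix.diagonal (fun i => ((hX.eigenvalues i : ℂ) - (y : ℂ) * Complex.I)⁻¹)
          * star U := by
  set U₀ : Matrix V V ℝ := (hX.eigenvectorUnitary : Matrix V V ℝ) with hU₀
  have hU1 : U₀ * star U₀ = 1 := (Matrix.mem_unitaryGroup_iff).1 hX.eigenvectorUnitary.2
  set U : Matrix V V ℂ := U₀.map Complex.ofReal with hU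
  have hstar : star U = (star U₀).map Complex.ofReal := by
    ext i j; simp [hU, Matrix.star_apply]
  have hmul : ∀ A B : Matrix V V ℝ, (A * B).map Complex.ofReal
      = A.map Complex.ofReal * B.map Complex.ofReal := fun A B =>
    Matrix.map_mul (f := Complex.ofRealHom)
  have hUU : U * star U = 1 := by
    rw [hstar, ← hmul, hU1]; ext i j; simp [Matrix.one_apply]; split_ifs <;> simp
  have hUU' : star U * U = 1 := mul_eq_one_comm.1 hUU
  have hspec : X.map Complex.ofReal
      = U * Matrix.diagonal (fun i => (hX.eigenvalues i : ℂ)) * star U := by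
    have h := hX.spectral_theorem
    rw [Unitary.conjStarAlgAut_apply] at h
    conv_lhs => rw [h]
    rw [hmul, hmul, hstar, Matrix.diagonal_map (by simp)]
    rfl
  set D : Matrix V V ℂ := Matrix.diagonal fun i => ((hX.eigenvalues i : ℂ) - (y : ℂ) * Complex.I)
  set D' : Matrix V V ℂ :=
    Matrix.diagonal fun i => ((hX.eigenvalues i : ℂ) - (y : ℂ) * Complex.I)⁻¹
  have hDD : D * D' = 1 := by
    simp only [D, D', Matrix.diagonal_mul_diagonal]
    rw [← Matrix.diagonal_one]
    congr 1; ext i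
    exact mul_inv_cancel₀ (ofReal_sub_mul_I_ne_zero _ hy)
  have hM : X.map Complex.ofReal - ((y : ℂ) * Complex.I) • (1 : Matrix V V ℂ) = U * D * star U := by
    have hD : D = Matrix.diagonal (fun i => (hX.eigenvalues i : ℂ))
        - ((y : ℂ) * Complex.I) • (1 : Matrix V V ℂ) := by
      ext i j
      by_cases hij : i = j <;> simp [D, hij]
    rw [hspec, hD, mul_sub, sub_mul, mul_smul_comm, smul_mul_assoc, mul_one, hUU]
  have hinv : (X.map Complex.ofReal - ((y : ℂ) * Complex.I) • (1 : Matrix V V ℂ))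
      * (U * D' * star U) = 1 := by
    rw [hM]
    calc U * D * star U * (U * D' * star U) = U * (D * ((star U * U) * D')) * star U := by
          simp only [mul_assoc]
      _ = 1 := by rw [hUU', one_mul, hDD, mul_one, hUU]
  have hres : imResolvent X y = U * D' * star U := Matrix.inv_eq_right_inv hinv
  exact ⟨U, (Matrix.mem_unitaryGroup_iff).2 hUU, by rw [hres]; exact hinv, hres⟩

theorem trace_imResolvent {X : Matrix V V ℝ} (hX : X.IsHermitian) {y : ℝ} (hy : 0 < y) :
    (imResolvent X y).trace = ∑ i, ((hX.eigenvalues i : ℂ) - (y : ℂ) * Complex.I)⁻¹ := by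
  obtain ⟨U, hU, -, h⟩ := imResolvent_spectral hX hy
  rw [h, Matrix.trace_mul_comm, ← mul_assoc, (Matrix.mem_unitaryGroup_iff').1 hU, one_mul,
    Matrix.trace_diagonal]

theorem map_ofReal_mul_imResolvent {X : Matrix V V ℝ} (hX : X.IsHermitian) {y : ℝ} (hy : 0 < y) :
    X.map Complex.ofReal * imResolvent X y = 1 + ((y : ℂ) * Complex.I) • imResolvent X y := by
  obtain ⟨U, hU, h, -⟩ := imResolvent_spectral hX hy
  rw [sub_mul, smul_mul_assoc, one_mul, sub_eq_iff_eq_add] at h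
  exact h

/-- First resolvent identity. -/
theorem imResolvent_sub_imResolvent {X Y : Matrix V V ℝ} (hX : X.IsHermitian) (hY : Y.IsHermitian)
    {y : ℝ} (hy : 0 < y) :
    imResolvent Y y - imResolvent X y
      = -(imResolvent X y * (Y - X).map Complex.ofReal * imResolvent Y y) := by
  obtain ⟨-, -, h1, -⟩ := imResolvent_spectral hX hy
  obtain ⟨-, -, h2, -⟩ := imResolvent_spectral hY hy
  have h1' := mul_eq_one_comm.1 h1
  have e : (Y - X).map Complex.ofReal
      = (Y.map Complex.ofReal - ((y : ℂ) * Complex.I) • (1 : Matrix V V ℂ))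
        - (X.map Complex.ofReal - ((y : ℂ) * Complex.I) • (1 : Matrix V V ℂ)) := by
    ext i j; simp
  rw [e, mul_sub, sub_mul, mul_assoc, h2, h1', mul_one, one_mul, neg_sub]

theorem norm_imResolvent_le {X : Matrix V V ℝ} (hX : X.IsHermitian) {y : ℝ} (hy : 0 < y) :
    ‖imResolvent X y‖ ≤ y⁻¹ := by
  obtain ⟨U, hU, -, h⟩ := imResolvent_spectral hX hy
  rw [h, CStarRing.norm_mul_mem_unitary _ (Unitary.star_mem hU),
    CStarRing.norm_mem_unitary_mul _ hU, Matrix.l2_opNorm_diagonal]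
  refine (pi_norm_le_iff_of_nonneg (inv_nonneg.2 hy.le)).2 fun i => ?_
  rw [norm_inv]
  refine inv_anti₀ hy ?_
  refine le_trans ?_ (Complex.abs_im_le_norm _)
  simp [abs_of_pos hy]

theorem norm_entry_le_l2_opNorm (A : Matrix V V ℂ) (i j : V) : ‖A i j‖ ≤ ‖A‖ := by
  have h := Matrix.l2_opNorm_mulVec A (EuclideanSpace.single j 1)
  rw [PiLp.norm_single, norm_one, mul_one] at h
  refine le_trans ?_ h
  refine le_trans (le_of_eq ?_) (PiLp.norm_apply_le _ i)
  simp

theorem norm_imResolvent_apply_le {X : Matrix V V ℝ} (hX : X.IsHermitian) {y : ℝ} (hy : 0 < y)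
    (i j : V) : ‖imResolvent X y i j‖ ≤ y⁻¹ :=
  (norm_entry_le_l2_opNorm _ i j).trans (norm_imResolvent_le hX hy)

theorem norm_imResolvent_mul_apply_le {X Y : Matrix V V ℝ} (hX : X.IsHermitian)
    (hY : Y.IsHermitian) {y : ℝ} (hy : 0 < y) (i j : V) :
    ‖(imResolvent X y * imResolvent Y y) i j‖ ≤ y⁻¹ ^ 2 := by
  refine (norm_entry_le_l2_opNorm _ i j).trans ((norm_mul_le _ _).trans ?_)
  rw [sq]
  exact mul_le_mul (norm_imResolvent_le hX hy) (norm_imResolvent_le hY hy) (norm_nonneg _)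
    (inv_nonneg.2 hy.le)

/-- Each column sum is a diagonal entry of `Aᴴ * A`, hence at most `‖A‖²`. This saves a factor `n`
over the entrywise bound and makes the sum of the `R j i ^ 2` negligible. -/
theorem sum_norm_sq_imResolvent_le {X : Matrix V V ℝ} (hX : X.IsHermitian) {y : ℝ} (hy : 0 < y) :
    ∑ i, ∑ j, ‖imResolvent X y j i‖ ^ 2 ≤ Fintype.card V * y⁻¹ ^ 2 := by
  have h : ∀ i, ∑ j, ‖imResolvent X y j i‖ ^ 2 ≤ y⁻¹ ^ 2 := by
    intro i
    set A := imResolvent X y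
    have h1 : (Aᴴ * A) i i = ((∑ j, ‖A j i‖ ^ 2 : ℝ) : ℂ) := by
      rw [Matrix.mul_apply]
      push_cast
      refine Finset.sum_congr rfl fun j _ => ?_
      rw [Matrix.conjTranspose_apply, Complex.star_def, Complex.conj_mul']
    have h2 := norm_entry_le_l2_opNorm (Aᴴ * A) i i
    rw [h1, Complex.norm_real, Real.norm_of_nonneg (by positivity),
      Matrix.l2_opNorm_conjTranspose_mul_self, ← sq] at h2
    exact h2.trans (pow_le_pow_left₀ (norm_nonneg _) (norm_imResolvent_le hX hy) 2)
  refine (Finset.sum_le_sum fun i _ => h i).trans ?_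
  simp

/-- The normalized trace of the resolvent. -/
noncomputable def imStieltjes (X : Matrix V V ℝ) (y : ℝ) : ℂ :=
  (Fintype.card V : ℂ)⁻¹ * (imResolvent X y).trace

theorem norm_imStieltjes_le {X : Matrix V V ℝ} (hX : X.IsHermitian) {y : ℝ} (hy : 0 < y) :
    ‖imStieltjes X y‖ ≤ y⁻¹ := by
  rw [imStieltjes, norm_mul, norm_inv, Complex.norm_natCast]
  have h : ‖(imResolvent X y).trace‖ ≤ Fintype.card V * y⁻¹ := by
    refine (norm_sum_le _ _).trans ?_
    refine (Finset.sum_le_sum fun i _ => norm_imResolvent_apply_le hX hy i i).trans ?_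
    simp
  rcases Nat.eq_zero_or_pos (Fintype.card V) with h0 | h0
  · rw [h0]; simp; positivity
  · have : (0 : ℝ) < Fintype.card V := by exact_mod_cast h0
    rw [inv_mul_le_iff₀ this]
    exact h

theorem imStieltjes_im_nonneg {X : Matrix V V ℝ} (hX : X.IsHermitian) {y : ℝ} (hy : 0 < y) :
    0 ≤ (imStieltjes X y).im := by
  rw [imStieltjes, trace_imResolvent hX hy, ← Complex.ofReal_natCast, ← Complex.ofReal_inv,
    Complex.im_ofReal_mul, Complex.im_sum]
  refine mul_nonneg (by positivity) (Finset.sum_nonneg fun i _ => ?_)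
  rw [Complex.inv_im]
  refine div_nonneg ?_ (Complex.normSq_nonneg _)
  simp [hy.le]

/-- `Re (1 + i y s)` as a sum over the eigenvalues. -/
theorem one_add_re_imStieltjes [Nonempty V] {X : Matrix V V ℝ} (hX : X.IsHermitian) {y : ℝ}
    (hy : 0 < y) :
    1 - y * (imStieltjes X y).im
      = (Fintype.card V : ℝ)⁻¹ * ∑ i, hX.eigenvalues i ^ 2 / (hX.eigenvalues i ^ 2 + y ^ 2) := by
  have hc : (Fintype.card V : ℝ) ≠ 0 := by exact_mod_cast Fintype.card_ne_zero
  have h : (imStieltjes X y).im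
      = (Fintype.card V : ℝ)⁻¹ * ∑ i, y / (hX.eigenvalues i ^ 2 + y ^ 2) := by
    rw [imStieltjes, trace_imResolvent hX hy, ← Complex.ofReal_natCast, ← Complex.ofReal_inv,
      Complex.im_ofReal_mul, Complex.im_sum]
    congr 1
    refine Finset.sum_congr rfl fun i _ => ?_
    rw [Complex.inv_im]
    simp [Complex.normSq_apply]
    ring
  rw [h, ← mul_assoc, mul_comm y, mul_assoc, Finset.mul_sum]
  have h1 : (1 : ℝ) = (Fintype.card V : ℝ)⁻¹ * ∑ _i : V, (1 : ℝ) := by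
    simp [hc]
  rw [h1, ← mul_sub, ← Finset.sum_sub_distrib]
  congr 1
  refine Finset.sum_congr rfl fun i _ => ?_
  have : hX.eigenvalues i ^ 2 + y ^ 2 ≠ 0 := by positivity
  field_simp
  ring

theorem sum_eigenvalues_sq {X : Matrix V V ℝ} (hX : X.IsHermitian) :
    ∑ i, hX.eigenvalues i ^ 2 = ∑ i, ∑ j, X i j ^ 2 := by
  have h : (X * X).trace = ∑ i, hX.eigenvalues i ^ 2 := by
    have h := hX.spectral_theorem
    rw [Unitary.conjStarAlgAut_apply] at h
    set U : Matrix V V ℝ := (hX.eigenvectorUnitary : Matrix V V ℝ)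
    have hUU : star U * U = 1 := (Matrix.mem_unitaryGroup_iff').1 hX.eigenvectorUnitary.2
    set D : Matrix V V ℝ := Matrix.diagonal (RCLike.ofReal ∘ hX.eigenvalues)
    have h2 : X * X = U * (D * D) * star U := by
      conv_lhs => rw [h]
      calc U * D * star U * (U * D * star U) = U * (D * ((star U * U) * D)) * star U := by
            simp only [mul_assoc]
        _ = _ := by rw [hUU, one_mul]
    rw [h2, Matrix.trace_mul_comm, ← mul_assoc, hUU, one_mul]
    simp [D, Matrix.diagonal_mul_diagonal, Matrix.trace_diagonal, sq]
  rw [← h, Matrix.trace]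
  refine Finset.sum_congr rfl fun i _ => ?_
  rw [Matrix.diag_apply, Matrix.mul_apply]
  refine Finset.sum_congr rfl fun j _ => ?_
  have := hX.apply i j
  simp at this
  rw [this, sq]

end Resolvent

/-! ### Expectations over the random graph and resampling of one edge. -/

section Resampling

set_option linter.unusedSectionVars false

variable {V : Type*} [Fintype V] [DecidableEq V]

/-- The probability of a single graph under `G(V, p)`. -/
noncomputable def graphWeight (p : unitInterval) (G : SimpleGraph V) : ℝ :=
  (SimpleGraph.binomialRandom V p).real {G}

/-- Expectation with respect to the binomial random graph. -/
noncomputable def graphExp {E : Type*} [AddCommGroup E] [Module ℝ E] (p : unitInterval)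
    (F : SimpleGraph V → E) : E :=
  ∑ G, graphWeight p G • F G

theorem graphWeight_nonneg (p : unitInterval) (G : SimpleGraph V) : 0 ≤ graphWeight p G :=
  MeasureTheory.measureReal_nonneg

theorem measurableSet_singleton_graph (G : SimpleGraph V) : MeasurableSet {G} := by
  have : {G} = SimpleGraph.edgeSet ⁻¹' {G.edgeSet} := by
    ext H; simp
  rw [this]
  exact SimpleGraph.measurable_edgeSet (MeasurableSet.singleton _)

theorem binomialRandom_real_apply (p : unitInterval) (S : Set (SimpleGraph V))
    [DecidablePred (· ∈ S)] :
    (SimpleGraph.binomialRandom V p).real S = graphExp p fun G => if G ∈ S then (1 : ℝ) else 0 := by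
  have : MeasurableSingletonClass (SimpleGraph V) := ⟨measurableSet_singleton_graph⟩
  have h := MeasureTheory.sum_measureReal_singleton (μ := SimpleGraph.binomialRandom V p)
    (Finset.univ.filter (· ∈ S))
  have h2 : ((Finset.univ.filter (· ∈ S) : Finset (SimpleGraph V)) : Set (SimpleGraph V)) = S := by
    ext; simp
  rw [h2] at h
  rw [← h, Finset.sum_filter]
  refine Finset.sum_congr rfl fun G _ => ?_
  by_cases hG : G ∈ S <;> simp [graphWeight, hG]

theorem sum_graphWeight (p : unitInterval) : ∑ G : SimpleGraph V, graphWeight p G = 1 := by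
  classical
  have h := binomialRandom_real_apply p (Set.univ : Set (SimpleGraph V))
  simp only [Set.mem_univ, if_true, graphExp, smul_eq_mul, mul_one] at h
  rw [← h]
  simp

theorem graphWeight_eq (p : unitInterval) (G : SimpleGraph V) :
    graphWeight p G = (p : ℝ) ^ G.edgeSet.ncard
      * (1 - p : ℝ) ^ ((Fintype.card V).choose 2 - G.edgeSet.ncard) := by
  rw [graphWeight, MeasureTheory.measureReal_def, SimpleGraph.binomialRandom_singleton]
  simp

/-- The odds of an edge are `p : (1 - p)`; the product form avoids dividing by `1 - p`. -/
theorem graphWeight_sup_edge (p : unitInterval) {G : SimpleGraph V} {i j : V} (hij : i ≠ j)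
    (hG : ¬ G.Adj i j) :
    graphWeight p (G ⊔ SimpleGraph.edge i j) * (1 - p) = graphWeight p G * p := by
  classical
  have h1 : (G ⊔ SimpleGraph.edge i j).edgeSet.ncard = G.edgeSet.ncard + 1 := by
    have := G.card_edgeFinset_sup_edge hG hij
    rwa [← Set.ncard_coe_finset, ← Set.ncard_coe_finset, SimpleGraph.coe_edgeFinset,
      SimpleGraph.coe_edgeFinset] at this
  have h2 : (G ⊔ SimpleGraph.edge i j).edgeSet.ncard ≤ (Fintype.card V).choose 2 := by
    have := (G ⊔ SimpleGraph.edge i j).card_edgeFinset_le_card_choose_two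
    rwa [← Set.ncard_coe_finset, SimpleGraph.coe_edgeFinset] at this
  rw [graphWeight_eq, graphWeight_eq, h1]
  have h3 : (Fintype.card V).choose 2 - G.edgeSet.ncard
      = (Fintype.card V).choose 2 - (G.edgeSet.ncard + 1) + 1 := by omega
  rw [h3]
  ring

theorem sup_edge_sdiff_edge {G : SimpleGraph V} {i j : V} (hG : ¬ G.Adj i j) :
    (G ⊔ SimpleGraph.edge i j) \ SimpleGraph.edge i j = G := by
  rw [sup_sdiff_right_self, G.sdiff_edge hG]

theorem sdiff_edge_sup_edge {G : SimpleGraph V} {i j : V} (hG : G.Adj i j) :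
    G \ SimpleGraph.edge i j ⊔ SimpleGraph.edge i j = G := by
  rw [sdiff_sup_self, SimpleGraph.sup_edge_of_adj G hG]

/-- Resampling the edge `ij` does not change expectations. -/
theorem graphExp_resample {E : Type*} [AddCommGroup E] [Module ℝ E] (p : unitInterval) {i j : V}
    (hij : i ≠ j) (F : SimpleGraph V → E) :
    graphExp p F = graphExp p fun G =>
      (p : ℝ) • F (G ⊔ SimpleGraph.edge i j) + (1 - p : ℝ) • F (G \ SimpleGraph.edge i j) := by
  classical
  -- Graphs are paired by toggling the edge `ij`, each pair being represented by its member without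
  -- the edge.
  have split : ∀ g : SimpleGraph V → E, ∑ G, g G
      = ∑ G ∈ Finset.univ.filter (fun G : SimpleGraph V => ¬ G.Adj i j),
        (g (G ⊔ SimpleGraph.edge i j) + g G) := by
    intro g
    rw [Finset.sum_add_distrib,
      ← Finset.sum_filter_add_sum_filter_not Finset.univ (fun G : SimpleGraph V => G.Adj i j)]
    congr 1
    refine Finset.sum_bij' (fun G _ => G \ SimpleGraph.edge i j)
      (fun G _ => G ⊔ SimpleGraph.edge i j) ?_ ?_ ?_ ?_ ?_
    · intro G _
      simp [SimpleGraph.edge_adj, hij]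
    · intro G _
      simp [SimpleGraph.edge_adj, hij]
    · intro G hG
      exact sdiff_edge_sup_edge (by simpa using hG)
    · intro G hG
      exact sup_edge_sdiff_edge (by simpa using hG)
    · intro G hG
      rw [sdiff_edge_sup_edge (by simpa using hG)]
  rw [graphExp, graphExp, split, split]
  refine Finset.sum_congr rfl fun G hG => ?_
  have hG : ¬ G.Adj i j := by simpa using hG
  have hw := graphWeight_sup_edge p hij hG
  rw [sup_edge_sdiff_edge hG, sup_assoc, sup_idem, SimpleGraph.sdiff_edge G hG, ← add_smul,
    smul_add, smul_smul, smul_smul]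
  congr 2 <;> linarith

theorem graphExp_add {E : Type*} [AddCommGroup E] [Module ℝ E] (p : unitInterval)
    (F H : SimpleGraph V → E) :
    graphExp p (fun G => F G + H G) = graphExp p F + graphExp p H := by
  simp [graphExp, smul_add, Finset.sum_add_distrib]

theorem graphExp_sub {E : Type*} [AddCommGroup E] [Module ℝ E] (p : unitInterval)
    (F H : SimpleGraph V → E) :
    graphExp p (fun G => F G - H G) = graphExp p F - graphExp p H := by
  simp [graphExp, smul_sub, Finset.sum_sub_distrib]

theorem graphExp_sum {E ι : Type*} [AddCommGroup E] [Module ℝ E] (p : unitInterval)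
    (s : Finset ι) (F : ι → SimpleGraph V → E) :
    graphExp p (fun G => ∑ k ∈ s, F k G) = ∑ k ∈ s, graphExp p (F k) := by
  simp only [graphExp, Finset.smul_sum]
  exact Finset.sum_comm

theorem graphExp_const_mul {𝕜 : Type*} [RCLike 𝕜] (p : unitInterval) (c : 𝕜)
    (F : SimpleGraph V → 𝕜) :
    graphExp p (fun G => c * F G) = c * graphExp p F := by
  simp only [graphExp, Finset.mul_sum, mul_smul_comm]

theorem norm_graphExp_le {E : Type*} [NormedAddCommGroup E] [NormedSpace ℝ E] (p : unitInterval)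
    {F : SimpleGraph V → E} {K : ℝ} (h : ∀ G, ‖F G‖ ≤ K) : ‖graphExp p F‖ ≤ K := by
  calc ‖graphExp p F‖ ≤ ∑ G : SimpleGraph V, graphWeight p G * K := by
        refine (norm_sum_le _ _).trans (Finset.sum_le_sum fun G _ => ?_)
        rw [norm_smul, Real.norm_of_nonneg (graphWeight_nonneg p G)]
        exact mul_le_mul_of_nonneg_left (h G) (graphWeight_nonneg p G)
    _ = K := by rw [← Finset.sum_mul, sum_graphWeight, one_mul]

theorem graphExp_mono (p : unitInterval) {F H : SimpleGraph V → ℝ} (h : ∀ G, F G ≤ H G) :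
    graphExp p F ≤ graphExp p H :=
  Finset.sum_le_sum fun G _ => mul_le_mul_of_nonneg_left (h G) (graphWeight_nonneg p G)

theorem graphExp_nonneg (p : unitInterval) {F : SimpleGraph V → ℝ} (h : ∀ G, 0 ≤ F G) :
    0 ≤ graphExp p F :=
  Finset.sum_nonneg fun G _ => mul_nonneg (graphWeight_nonneg p G) (h G)

/-- Jensen's inequality for the square. -/
theorem sq_graphExp_le (p : unitInterval) (F : SimpleGraph V → ℝ) :
    graphExp p F ^ 2 ≤ graphExp p fun G => F G ^ 2 := by
  have h := graphExp_nonneg p (F := fun G => (F G - graphExp p F) ^ 2) fun G => sq_nonneg _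
  have h2 : graphExp p (fun G => (F G - graphExp p F) ^ 2)
      = graphExp p (fun G => F G ^ 2) - graphExp p F ^ 2 := by
    set m := graphExp p F with hm
    have e : (fun G => (F G - m) ^ 2) = fun G => (F G ^ 2 - 2 * m * F G) + m ^ 2 * 1 := by
      ext G; ring
    rw [e, graphExp_add, graphExp_sub, graphExp_const_mul, graphExp_const_mul, ← hm]
    have : graphExp p (fun _ : SimpleGraph V => (1 : ℝ)) = 1 := by
      simp [graphExp, sum_graphWeight]
    rw [this]; ring
  linarith

/-- The probability that none of the vertices in `S` is a common neighbour of `i` and `j`. -/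
theorem graphExp_no_common_neighbor (p : unitInterval) {i j : V} (hij : i ≠ j) (S : Finset V)
    (hi : i ∉ S) (hj : j ∉ S) [∀ G : SimpleGraph V, DecidableRel G.Adj] :
    graphExp p (fun G => if ∀ k ∈ S, ¬ (G.Adj i k ∧ G.Adj k j) then (1 : ℝ) else 0)
      = (1 - (p : ℝ) ^ 2) ^ S.card := by
  induction S using Finset.induction_on with
  | empty => simp [graphExp, sum_graphWeight]
  | insert k S hk ih =>
    simp only [Finset.mem_insert, not_or] at hi hj
    have ih := ih hi.2 hj.2
    rw [graphExp_resample p (i := i) (j := k) hi.1, graphExp_resample p (i := k) (j := j)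
      (Ne.symm hj.1), Finset.card_insert_of_notMem hk, pow_succ, ← ih, mul_comm,
      ← graphExp_const_mul]
    congr 1
    ext G
    have hS : ∀ v ∈ S, v ≠ i ∧ v ≠ j ∧ v ≠ k := fun v hv =>
      ⟨fun h => hi.2 (h ▸ hv), fun h => hj.2 (h ▸ hv), fun h => hk (h ▸ hv)⟩
    -- The edges `ik` and `kj` do not affect the condition at the other vertices of `S`, so
    -- averaging over them only contributes a factor `1 - p²`.
    have inv : ∀ H : SimpleGraph V, (∀ v ∈ S, (H.Adj i v ↔ G.Adj i v) ∧ (H.Adj v j ↔ G.Adj v j)) →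
        ((∀ v ∈ insert k S, ¬ (H.Adj i v ∧ H.Adj v j)) ↔
          ¬ (H.Adj i k ∧ H.Adj k j) ∧ ∀ v ∈ S, ¬ (G.Adj i v ∧ G.Adj v j)) := by
      intro H hH
      rw [Finset.forall_mem_insert]
      refine and_congr Iff.rfl (forall₂_congr fun v hv => ?_)
      rw [(hH v hv).1, (hH v hv).2]
    have hki : k ≠ i := Ne.symm hi.1
    have hkj : k ≠ j := Ne.symm hj.1
    rw [if_congr (inv _ _) rfl rfl, if_congr (inv _ _) rfl rfl, if_congr (inv _ _) rfl rfl,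
      if_congr (inv _ _) rfl rfl]
    · have e1 : ∀ H : SimpleGraph V, (H ⊔ SimpleGraph.edge i k).Adj i k := fun H => by
        simp [SimpleGraph.edge_adj, hki.symm]
      have e2 : ∀ H : SimpleGraph V, ¬ (H \ SimpleGraph.edge i k).Adj i k := fun H => by
        simp [SimpleGraph.edge_adj, hki.symm]
      have e3 : ∀ H : SimpleGraph V, (H ⊔ SimpleGraph.edge k j).Adj k j := fun H => by
        simp [SimpleGraph.edge_adj, hkj]
      have e4 : ∀ H : SimpleGraph V, ¬ (H \ SimpleGraph.edge k j).Adj k j := fun H => by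
        simp [SimpleGraph.edge_adj, hkj]
      have e7 : ∀ H : SimpleGraph V, (H ⊔ SimpleGraph.edge i k).Adj k j ↔ H.Adj k j := fun H => by
        simp [SimpleGraph.edge_adj, hij.symm, hki]
      have e8 : ∀ H : SimpleGraph V, (H \ SimpleGraph.edge i k).Adj k j ↔ H.Adj k j := fun H => by
        simp [SimpleGraph.edge_adj, hij.symm, hki]
      by_cases hP : ∀ v ∈ S, ¬ (G.Adj i v ∧ G.Adj v j)
      · simp only [e1, e2, e3, e4, e7, e8, eq_true hP]
        simp
        ring
      · simp only [eq_false hP]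
        simp
    all_goals
      intro v hv
      obtain ⟨h1, h2, h3⟩ := hS v hv
      simp [SimpleGraph.edge_adj, h1, h2, h3, h1.symm, hij, hij.symm]

end Resampling

/-! ### The normalized adjacency matrix and the effect of toggling one edge. -/

section SelfConsistent

set_option linter.unusedSectionVars false

variable {V : Type*} [Fintype V] [DecidableEq V]

open Classical in
/-- The centred adjacency matrix of a graph, normalized by `1 / √n`. -/
noncomputable def normalizedAdj (p : unitInterval) (G : SimpleGraph V) : Matrix V V ℝ :=
  Matrix.of fun i j =>
    if i = j then 0 else (√(Fintype.card V))⁻¹ * ((if G.Adj i j then 1 else 0) - p)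

theorem normalizedAdj_isHermitian (p : unitInterval) (G : SimpleGraph V) :
    (normalizedAdj p G).IsHermitian := by
  ext i j
  by_cases hij : i = j
  · simp [normalizedAdj, hij]
  · by_cases hG : G.Adj i j
    · simp [normalizedAdj, hij, Ne.symm hij, hG, hG.symm]
    · have hG' : ¬ G.Adj j i := fun h => hG h.symm
      simp [normalizedAdj, hij, Ne.symm hij, hG, hG']

theorem normalizedAdj_sup_edge_apply (p : unitInterval) (G : SimpleGraph V) {i j : V}
    (hij : i ≠ j) :
    normalizedAdj p (G ⊔ SimpleGraph.edge i j) i j = (√(Fintype.card V))⁻¹ * (1 - p) := by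
  simp [normalizedAdj, hij, SimpleGraph.edge_adj]

theorem normalizedAdj_sdiff_edge_apply (p : unitInterval) (G : SimpleGraph V) {i j : V}
    (hij : i ≠ j) :
    normalizedAdj p (G \ SimpleGraph.edge i j) i j = (√(Fintype.card V))⁻¹ * (-p) := by
  simp [normalizedAdj, hij, SimpleGraph.edge_adj]

theorem normalizedAdj_sup_sub_sdiff (p : unitInterval) (G : SimpleGraph V) {i j : V}
    (hij : i ≠ j) :
    normalizedAdj p (G ⊔ SimpleGraph.edge i j) - normalizedAdj p (G \ SimpleGraph.edge i j)
      = (√(Fintype.card V))⁻¹ • (Matrix.single i j 1 + Matrix.single j i 1) := by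
  ext a b
  simp only [normalizedAdj, Matrix.sub_apply, Matrix.of_apply, Matrix.smul_apply, Matrix.add_apply,
    Matrix.single_apply, smul_eq_mul]
  by_cases hab : a = b
  · subst hab
    have h1 : ¬ (i = a ∧ j = a) := fun h => hij (h.1.trans h.2.symm)
    have h2 : ¬ (j = a ∧ i = a) := fun h => hij (h.2.trans h.1.symm)
    simp [h1, h2]
  · by_cases h1 : i = a ∧ j = b
    · obtain ⟨rfl, rfl⟩ := h1
      have e1 : (G ⊔ SimpleGraph.edge i j).Adj i j := by simp [SimpleGraph.edge_adj, hij]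
      have e2 : ¬ (G \ SimpleGraph.edge i j).Adj i j := by simp [SimpleGraph.edge_adj, hij]
      simp [hij, hij.symm, e1, e2]
      ring
    · by_cases h2 : j = a ∧ i = b
      · obtain ⟨rfl, rfl⟩ := h2
        have e1 : (G ⊔ SimpleGraph.edge i j).Adj j i := by simp [SimpleGraph.edge_adj, hij.symm]
        have e2 : ¬ (G \ SimpleGraph.edge i j).Adj j i := by
          simp [SimpleGraph.edge_adj, hij.symm]
        simp [hij, hij.symm, e1, e2]
        ring
      · have h1' : ¬ (a = i ∧ b = j) := fun h => h1 ⟨h.1.symm, h.2.symm⟩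
        have h2' : ¬ (a = j ∧ b = i) := fun h => h2 ⟨h.1.symm, h.2.symm⟩
        have e1 : (G ⊔ SimpleGraph.edge i j).Adj a b ↔ G.Adj a b := by
          simp [SimpleGraph.edge_adj, h1', h2']
        have e2 : (G \ SimpleGraph.edge i j).Adj a b ↔ G.Adj a b := by
          simp [SimpleGraph.edge_adj, h1', h2']
        by_cases hG : G.Adj a b
        · simp [h1, h2, hab, e1.2 hG, e2.2 hG]
        · simp [h1, h2, hab, mt e1.1 hG, mt e2.1 hG]

/-- Toggling an edge changes the matrix by two entries, so the resolvent identity collapses to two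
products of resolvent entries. -/
theorem imResolvent_sup_sub_sdiff_apply (p : unitInterval) (G : SimpleGraph V) {i j : V}
    (hij : i ≠ j) {y : ℝ} (hy : 0 < y) (a b : V) :
    imResolvent (normalizedAdj p (G ⊔ SimpleGraph.edge i j)) y a b
        - imResolvent (normalizedAdj p (G \ SimpleGraph.edge i j)) y a b
      = -((√(Fintype.card V))⁻¹ : ℝ)
        * (imResolvent (normalizedAdj p (G \ SimpleGraph.edge i j)) y a i
            * imResolvent (normalizedAdj p (G ⊔ SimpleGraph.edge i j)) y j b
          + imResolvent (normalizedAdj p (G \ SimpleGraph.edge i j)) y a j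
            * imResolvent (normalizedAdj p (G ⊔ SimpleGraph.edge i j)) y i b) := by
  have h := imResolvent_sub_imResolvent
    (normalizedAdj_isHermitian p (G \ SimpleGraph.edge i j))
    (normalizedAdj_isHermitian p (G ⊔ SimpleGraph.edge i j)) hy
  rw [normalizedAdj_sup_sub_sdiff p G hij] at h
  set R₀ := imResolvent (normalizedAdj p (G \ SimpleGraph.edge i j)) y
  set R₁ := imResolvent (normalizedAdj p (G ⊔ SimpleGraph.edge i j)) y
  have hmap : ((√(Fintype.card V))⁻¹ • (Matrix.single i j 1 + Matrix.single j i 1)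
      : Matrix V V ℝ).map Complex.ofReal
      = (((√(Fintype.card V))⁻¹ : ℝ) : ℂ) • (Matrix.single i j 1 + Matrix.single j i 1) := by
    ext a b
    simp only [Matrix.map_apply, Matrix.smul_apply, Matrix.add_apply, Matrix.single_apply]
    split_ifs <;> simp
  have hsingle : ∀ u v : V, (R₀ * Matrix.single u v (1 : ℂ) * R₁) a b = R₀ a u * R₁ v b := by
    intro u v
    rw [mul_assoc, Matrix.mul_apply, Finset.sum_eq_single u]
    · simp
    · intro k _ hk
      rw [Matrix.single_mul_apply_of_ne _ _ _ _ _ hk, mul_zero]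
    · simp
  have h2 := congrFun (congrFun h a) b
  rw [hmap, Matrix.sub_apply] at h2
  rw [h2, mul_smul_comm, smul_mul_assoc, mul_add, add_mul, Matrix.neg_apply, Matrix.smul_apply,
    Matrix.add_apply, hsingle, hsingle, smul_eq_mul]
  ring

theorem norm_imResolvent_sup_sub_sdiff_apply_le (p : unitInterval) (G : SimpleGraph V) {i j : V}
    (hij : i ≠ j) {y : ℝ} (hy : 0 < y) (a b : V) :
    ‖imResolvent (normalizedAdj p (G ⊔ SimpleGraph.edge i j)) y a b
        - imResolvent (normalizedAdj p (G \ SimpleGraph.edge i j)) y a b‖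
      ≤ 2 * (√(Fintype.card V))⁻¹ * y⁻¹ ^ 2 := by
  rw [imResolvent_sup_sub_sdiff_apply p G hij hy, norm_mul, norm_neg, Complex.norm_real,
    Real.norm_of_nonneg (by positivity), mul_comm (2 : ℝ), mul_assoc]
  refine mul_le_mul_of_nonneg_left ?_ (by positivity)
  have hb : ∀ (H : SimpleGraph V) (u v : V), ‖imResolvent (normalizedAdj p H) y u v‖ ≤ y⁻¹ :=
    fun H u v => norm_imResolvent_apply_le (normalizedAdj_isHermitian p H) hy u v
  have hprod : ∀ (H K : SimpleGraph V) (u v w x : V),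
      ‖imResolvent (normalizedAdj p H) y u v * imResolvent (normalizedAdj p K) y w x‖
        ≤ y⁻¹ ^ 2 := by
    intro H K u v w x
    rw [norm_mul, sq]
    exact mul_le_mul (hb _ _ _) (hb _ _ _) (norm_nonneg _) (by positivity)
  refine (norm_add_le _ _).trans ?_
  linarith [hprod (G \ SimpleGraph.edge i j) (G ⊔ SimpleGraph.edge i j) a i j b,
    hprod (G \ SimpleGraph.edge i j) (G ⊔ SimpleGraph.edge i j) a j i b]

/-- In the trace, the sum over `a` turns the products of entries into entries of a product of two
resolvents, bounded by `y⁻¹ ^ 2` independently of `n`. With the factor `1 / n` the change is of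
order `n ^ (-3/2)`. -/
theorem norm_imStieltjes_sup_sub_sdiff_le (p : unitInterval) (G : SimpleGraph V) {i j : V}
    (hij : i ≠ j) {y : ℝ} (hy : 0 < y) :
    ‖imStieltjes (normalizedAdj p (G ⊔ SimpleGraph.edge i j)) y
        - imStieltjes (normalizedAdj p (G \ SimpleGraph.edge i j)) y‖
      ≤ 2 * (√(Fintype.card V))⁻¹ ^ 3 * y⁻¹ ^ 2 := by
  set G₁ := G ⊔ SimpleGraph.edge i j with hG₁
  set G₀ := G \ SimpleGraph.edge i j with hG₀
  have h : imStieltjes (normalizedAdj p G₁) y - imStieltjes (normalizedAdj p G₀) y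
      = (Fintype.card V : ℂ)⁻¹ * (-((√(Fintype.card V))⁻¹ : ℝ)
        * ((imResolvent (normalizedAdj p G₁) y * imResolvent (normalizedAdj p G₀) y) j i
          + (imResolvent (normalizedAdj p G₁) y * imResolvent (normalizedAdj p G₀) y) i j)) := by
    rw [imStieltjes, imStieltjes, ← mul_sub]
    congr 1
    rw [Matrix.trace, Matrix.trace, ← Finset.sum_sub_distrib, Matrix.mul_apply, Matrix.mul_apply,
      ← Finset.sum_add_distrib, Finset.mul_sum]
    refine Finset.sum_congr rfl fun a _ => ?_
    rw [Matrix.diag_apply, Matrix.diag_apply, imResolvent_sup_sub_sdiff_apply p G hij hy]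
    ring
  have hc : (Fintype.card V : ℝ)⁻¹ = (√(Fintype.card V))⁻¹ ^ 2 := by
    rw [inv_pow, Real.sq_sqrt (Nat.cast_nonneg _)]
  have hp : ∀ u v, ‖(imResolvent (normalizedAdj p G₁) y
      * imResolvent (normalizedAdj p G₀) y) u v‖ ≤ y⁻¹ ^ 2 := fun u v =>
    norm_imResolvent_mul_apply_le (normalizedAdj_isHermitian p G₁)
      (normalizedAdj_isHermitian p G₀) hy u v
  rw [h, norm_mul, norm_mul, norm_neg, norm_inv, Complex.norm_natCast, Complex.norm_real,
    Real.norm_of_nonneg (by positivity), hc, ← mul_assoc, ← pow_succ]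
  calc _ ≤ (√(Fintype.card V))⁻¹ ^ 3 * (y⁻¹ ^ 2 + y⁻¹ ^ 2) :=
        mul_le_mul_of_nonneg_left ((norm_add_le _ _).trans (add_le_add (hp _ _) (hp _ _)))
          (by positivity)
    _ = _ := by ring

/-- One step of the cumulant expansion, in abstract form. -/
theorem norm_discrete_expansion_le {φ₁ φ₀ u₁ u₀ v₁ v₀ w₁ w₀ : ℂ} {a c L δ : ℝ} (ha : 0 ≤ a)
    (hc : 0 ≤ c) (hL : 0 ≤ L) (hδ : 0 ≤ δ) (hδ1 : δ ≤ 1)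
    (hφ₁ : ‖φ₁‖ ≤ c) (hφ : ‖φ₁ - φ₀‖ ≤ L * δ ^ 3)
    (hu₁ : ‖u₁‖ ≤ a) (hu₀ : ‖u₀‖ ≤ a) (hv₁ : ‖v₁‖ ≤ a) (hv₀ : ‖v₀‖ ≤ a) (hw₀ : ‖w₀‖ ≤ a)
    (hu : ‖u₁ - u₀‖ ≤ 2 * δ * a ^ 2) (hv : ‖v₁ - v₀‖ ≤ 2 * δ * a ^ 2)
    (hw : ‖w₁ - w₀‖ ≤ 2 * δ * a ^ 2) (h : u₁ - u₀ = -(δ : ℂ) * (u₀ * u₁ + w₀ * v₁)) :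
    ‖φ₁ * u₁ - φ₀ * u₀ + δ * (φ₁ * (u₁ ^ 2 + v₁ * w₁))‖
        ≤ (4 * c * a ^ 3 + L * a + 2 * L * a ^ 2) * δ ^ 2 ∧
      ‖φ₁ * u₁ - φ₀ * u₀ + δ * (φ₀ * (u₀ ^ 2 + v₀ * w₀))‖
        ≤ (4 * c * a ^ 3 + L * a + 2 * L * a ^ 2) * δ ^ 2 := by
  have hn : ‖(δ : ℂ)‖ = δ := by rw [Complex.norm_real, Real.norm_of_nonneg hδ]
  have hδ3 : δ ^ 3 ≤ δ ^ 2 := pow_le_pow_of_le_one hδ hδ1 (by norm_num)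
  have hδ4 : δ ^ 4 ≤ δ ^ 2 := pow_le_pow_of_le_one hδ hδ1 (by norm_num)
  have hsecond : ‖(φ₁ - φ₀) * u₀‖ ≤ L * a * δ ^ 2 := by
    rw [norm_mul]
    calc ‖φ₁ - φ₀‖ * ‖u₀‖ ≤ L * δ ^ 3 * a := mul_le_mul hφ hu₀ (norm_nonneg _) (by positivity)
      _ = L * a * δ ^ 3 := by ring
      _ ≤ L * a * δ ^ 2 := mul_le_mul_of_nonneg_left hδ3 (by positivity)
  have hm : ∀ {x z : ℂ} {r : ℝ}, 0 ≤ r → ‖x‖ ≤ a → ‖z‖ ≤ r → ‖x * z‖ ≤ a * r :=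
    fun hr hx hz => by
      rw [norm_mul]; exact mul_le_mul hx hz (norm_nonneg _) ha
  have h2 : 0 ≤ 2 * δ * a ^ 2 := by positivity
  have hmain : ∀ z z' : ℂ, ‖z‖ ≤ a * (2 * δ * a ^ 2) → ‖z'‖ ≤ a * (2 * δ * a ^ 2) →
      ‖(δ : ℂ) * (φ₁ * (z + z'))‖ ≤ 4 * c * a ^ 3 * δ ^ 2 := by
    intro z z' hz hz'
    rw [norm_mul, norm_mul, hn]
    calc δ * (‖φ₁‖ * ‖z + z'‖)
        ≤ δ * (c * (a * (2 * δ * a ^ 2) + a * (2 * δ * a ^ 2))) :=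
          mul_le_mul_of_nonneg_left (mul_le_mul hφ₁ ((norm_add_le _ _).trans (add_le_add hz hz'))
            (norm_nonneg _) hc) hδ
      _ = _ := by ring
  have hLa : 0 ≤ L * a * δ ^ 2 := by positivity
  have hLaa : 0 ≤ 2 * L * a ^ 2 * δ ^ 2 := by positivity
  -- The two claims expand around the graph with and without the edge. In both, `h` replaces `u₁ -
  -- u₀` by products mixing the two states, and making the states agree costs another factor `δ`.
  constructor
  · have e : φ₁ * u₁ - φ₀ * u₀ + δ * (φ₁ * (u₁ ^ 2 + v₁ * w₁))
        = δ * (φ₁ * (u₁ * (u₁ - u₀) + v₁ * (w₁ - w₀))) + (φ₁ - φ₀) * u₀ := by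
      linear_combination φ₁ * h
    rw [e]
    refine (norm_add_le _ _).trans ?_
    linarith [hmain _ _ (hm h2 hu₁ hu) (hm h2 hv₁ hw)]
  · have e : φ₁ * u₁ - φ₀ * u₀ + δ * (φ₀ * (u₀ ^ 2 + v₀ * w₀))
        = δ * (φ₁ * (u₀ * (u₀ - u₁) + w₀ * (v₀ - v₁)))
          + ((φ₁ - φ₀) * u₀ - δ * ((φ₁ - φ₀) * (u₀ * u₀ + v₀ * w₀))) := by
      linear_combination φ₁ * h
    rw [norm_sub_rev] at hu hv
    have h3 : ‖(δ : ℂ) * ((φ₁ - φ₀) * (u₀ * u₀ + v₀ * w₀))‖ ≤ 2 * L * a ^ 2 * δ ^ 2 := by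
      rw [norm_mul, norm_mul, hn]
      calc δ * (‖φ₁ - φ₀‖ * ‖u₀ * u₀ + v₀ * w₀‖)
          ≤ δ * (L * δ ^ 3 * (a * a + a * a)) :=
            mul_le_mul_of_nonneg_left (mul_le_mul hφ ((norm_add_le _ _).trans
              (add_le_add (hm ha hu₀ hu₀) (hm ha hv₀ hw₀))) (norm_nonneg _) (by positivity)) hδ
        _ = 2 * L * a ^ 2 * δ ^ 4 := by ring
        _ ≤ _ := mul_le_mul_of_nonneg_left hδ4 (by positivity)
    rw [e]
    refine (norm_add_le _ _).trans ?_
    have := norm_sub_le ((φ₁ - φ₀) * u₀) (δ * ((φ₁ - φ₀) * (u₀ * u₀ + v₀ * w₀)))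
    linarith [hmain _ _ (hm h2 hu₀ hu) (hm h2 hw₀ hv)]

end SelfConsistent

/-! ### The self-consistent equation in mean square. -/

section SelfConsistentEquation

set_option linter.unusedSectionVars false

variable {V : Type*} [Fintype V] [DecidableEq V]

/-- The defect `1 + i y s + p (1 - p) s²` in the self-consistent equation of the semicircle law. -/
noncomputable def selfConsistentDefect (p : unitInterval) (y : ℝ) (G : SimpleGraph V) : ℂ :=
  1 + (y : ℂ) * Complex.I * imStieltjes (normalizedAdj p G) y
    + ((p * (1 - p) : ℝ) : ℂ) * imStieltjes (normalizedAdj p G) y ^ 2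

theorem variance_nonneg (p : unitInterval) : 0 ≤ (p : ℝ) * (1 - p) :=
  mul_nonneg p.2.1 (sub_nonneg.2 p.2.2)

theorem variance_le_one (p : unitInterval) : (p : ℝ) * (1 - p) ≤ 1 := by
  nlinarith [p.2.1, p.2.2]

theorem norm_selfConsistentDefect_le (p : unitInterval) {y : ℝ} (hy : 0 < y)
    (G : SimpleGraph V) : ‖selfConsistentDefect p y G‖ ≤ 2 + y⁻¹ ^ 2 := by
  have hs := norm_imStieltjes_le (normalizedAdj_isHermitian p G) hy
  set s := imStieltjes (normalizedAdj p G) y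
  have h1 : ‖(y : ℂ) * Complex.I * s‖ ≤ 1 := by
    rw [norm_mul, norm_mul, Complex.norm_I, mul_one, Complex.norm_real, Real.norm_of_nonneg hy.le]
    calc y * ‖s‖ ≤ y * y⁻¹ := mul_le_mul_of_nonneg_left hs hy.le
      _ = 1 := mul_inv_cancel₀ hy.ne'
  have h2 : ‖((p * (1 - p) : ℝ) : ℂ) * s ^ 2‖ ≤ y⁻¹ ^ 2 := by
    rw [norm_mul, norm_pow, Complex.norm_real, Real.norm_of_nonneg (variance_nonneg p)]
    calc (p : ℝ) * (1 - p) * ‖s‖ ^ 2 ≤ 1 * y⁻¹ ^ 2 :=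
          mul_le_mul (variance_le_one p) (pow_le_pow_left₀ (norm_nonneg _) hs 2) (by positivity)
            zero_le_one
      _ = _ := one_mul _
  have h3 := norm_add₃_le (a := (1 : ℂ)) (b := (y : ℂ) * Complex.I * s)
    (c := ((p * (1 - p) : ℝ) : ℂ) * s ^ 2)
  rw [norm_one] at h3
  unfold selfConsistentDefect
  linarith

theorem norm_selfConsistentDefect_sup_sub_sdiff_le (p : unitInterval) (G : SimpleGraph V)
    {i j : V} (hij : i ≠ j) {y : ℝ} (hy : 0 < y) :
    ‖selfConsistentDefect p y (G ⊔ SimpleGraph.edge i j)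
        - selfConsistentDefect p y (G \ SimpleGraph.edge i j)‖
      ≤ (y + 2 * y⁻¹) * (2 * y⁻¹ ^ 2) * (√(Fintype.card V))⁻¹ ^ 3 := by
  have h0 := norm_imStieltjes_le (normalizedAdj_isHermitian p (G \ SimpleGraph.edge i j)) hy
  have h1 := norm_imStieltjes_le (normalizedAdj_isHermitian p (G ⊔ SimpleGraph.edge i j)) hy
  have hd := norm_imStieltjes_sup_sub_sdiff_le p G hij hy
  unfold selfConsistentDefect
  set s₁ := imStieltjes (normalizedAdj p (G ⊔ SimpleGraph.edge i j)) y
  set s₀ := imStieltjes (normalizedAdj p (G \ SimpleGraph.edge i j)) y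
  have e : 1 + (y : ℂ) * Complex.I * s₁ + ((p * (1 - p) : ℝ) : ℂ) * s₁ ^ 2
      - (1 + (y : ℂ) * Complex.I * s₀ + ((p * (1 - p) : ℝ) : ℂ) * s₀ ^ 2)
      = ((y : ℂ) * Complex.I + ((p * (1 - p) : ℝ) : ℂ) * (s₁ + s₀)) * (s₁ - s₀) := by ring
  rw [e, norm_mul]
  have h2 : ‖(y : ℂ) * Complex.I + ((p * (1 - p) : ℝ) : ℂ) * (s₁ + s₀)‖ ≤ y + 2 * y⁻¹ := by
    refine (norm_add_le _ _).trans (add_le_add ?_ ?_)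
    · simp [abs_of_pos hy]
    · rw [norm_mul, Complex.norm_real, Real.norm_of_nonneg (variance_nonneg p)]
      calc (p : ℝ) * (1 - p) * ‖s₁ + s₀‖ ≤ 1 * (y⁻¹ + y⁻¹) :=
            mul_le_mul (variance_le_one p) ((norm_add_le _ _).trans (add_le_add h1 h0))
              (norm_nonneg _) zero_le_one
        _ = _ := by ring
  calc _ ≤ (y + 2 * y⁻¹) * (2 * (√(Fintype.card V))⁻¹ ^ 3 * y⁻¹ ^ 2) :=
        mul_le_mul h2 hd (norm_nonneg _) (by positivity)
    _ = _ := by ring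

/-- The `(i, j)` summand of the self-consistent equation. -/
noncomputable def selfConsistentTerm (p : unitInterval) (y : ℝ) (i j : V) (G : SimpleGraph V) : ℂ :=
  (normalizedAdj p G i j : ℂ) * imResolvent (normalizedAdj p G) y j i
    + ((p * (1 - p) * (√(Fintype.card V))⁻¹ ^ 2 : ℝ) : ℂ)
      * (imResolvent (normalizedAdj p G) y j i ^ 2
        + imResolvent (normalizedAdj p G) y i i * imResolvent (normalizedAdj p G) y j j)

/-- Discrete integration by parts. Averaging `φ * X i j * R j i` over the edge `ij` gives `p (1 - p)
δ` times a difference across the edge, where `δ = 1 / √n`. Its leading part is cancelled by the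
second summand of `selfConsistentTerm`; the rest is of order `δ ^ 3`. -/
theorem norm_graphExp_mul_selfConsistentTerm_le [Nonempty V] (p : unitInterval) {y : ℝ}
    (hy : 0 < y) {i j : V} (hij : i ≠ j) {φ : SimpleGraph V → ℂ} {c L : ℝ} (hc : 0 ≤ c)
    (hL : 0 ≤ L) (hφ : ∀ G, ‖φ G‖ ≤ c)
    (hφL : ∀ G : SimpleGraph V, ‖φ (G ⊔ SimpleGraph.edge i j) - φ (G \ SimpleGraph.edge i j)‖
      ≤ L * (√(Fintype.card V))⁻¹ ^ 3) :
    ‖graphExp p fun G => φ G * selfConsistentTerm p y i j G‖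
      ≤ (4 * c * y⁻¹ ^ 3 + L * y⁻¹ + 2 * L * y⁻¹ ^ 2) * (√(Fintype.card V))⁻¹ ^ 3 := by
  set δ : ℝ := (√(Fintype.card V))⁻¹ with hδ
  have hδ0 : 0 ≤ δ := by positivity
  have hδ1 : δ ≤ 1 := by
    refine inv_le_one_of_one_le₀ (Real.one_le_sqrt.2 ?_)
    exact_mod_cast Fintype.card_pos
  set R : SimpleGraph V → Matrix V V ℂ := fun G => imResolvent (normalizedAdj p G) y with hR
  have hRle : ∀ G u v, ‖R G u v‖ ≤ y⁻¹ := fun G u v =>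
    norm_imResolvent_apply_le (normalizedAdj_isHermitian p G) hy u v
  have e1 : (graphExp p fun G => φ G * selfConsistentTerm p y i j G)
      = graphExp p fun G => ((p * (1 - p) : ℝ) : ℂ) * δ
        * (φ (G ⊔ SimpleGraph.edge i j) * R (G ⊔ SimpleGraph.edge i j) j i
          - φ (G \ SimpleGraph.edge i j) * R (G \ SimpleGraph.edge i j) j i
          + δ * (φ G * (R G j i ^ 2 + R G i i * R G j j))) := by
    have e2 : (fun G => φ G * selfConsistentTerm p y i j G)
        = fun G => φ G * ((normalizedAdj p G i j : ℂ) * R G j i)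
          + ((p * (1 - p) : ℝ) : ℂ) * δ * (δ * (φ G * (R G j i ^ 2 + R G i i * R G j j))) := by
      ext G
      simp only [selfConsistentTerm, hR, ← hδ]
      push_cast
      ring
    rw [e2, graphExp_add, graphExp_resample p hij, ← graphExp_add]
    congr 1
    ext G
    rw [normalizedAdj_sup_edge_apply p G hij, normalizedAdj_sdiff_edge_apply p G hij, ← hδ,
      Complex.real_smul, Complex.real_smul]
    push_cast
    ring
  rw [e1]
  refine norm_graphExp_le p fun G => ?_
  have hu := norm_imResolvent_sup_sub_sdiff_apply_le p G hij hy j i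
  have hv := norm_imResolvent_sup_sub_sdiff_apply_le p G hij hy i i
  have hw := norm_imResolvent_sup_sub_sdiff_apply_le p G hij hy j j
  have hexp := norm_discrete_expansion_le (inv_nonneg.2 hy.le) hc hL hδ0 hδ1 (hφ _) (hφL G)
    (hRle _ j i) (hRle _ j i) (hRle _ i i) (hRle _ i i) (hRle _ j j) hu hv hw (by
      simp only [hR]
      rw [imResolvent_sup_sub_sdiff_apply p G hij hy j i])
  have hbound : ‖φ (G ⊔ SimpleGraph.edge i j) * R (G ⊔ SimpleGraph.edge i j) j i
          - φ (G \ SimpleGraph.edge i j) * R (G \ SimpleGraph.edge i j) j i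
          + δ * (φ G * (R G j i ^ 2 + R G i i * R G j j))‖
      ≤ (4 * c * y⁻¹ ^ 3 + L * y⁻¹ + 2 * L * y⁻¹ ^ 2) * δ ^ 2 := by
    -- `G` coincides with one of its two resampled versions, which selects the expansion to use.
    by_cases hG : G.Adj i j
    · have h := hexp.1
      rwa [SimpleGraph.sup_edge_of_adj G hG] at h ⊢
    · have h := hexp.2
      rwa [SimpleGraph.sdiff_edge G hG] at h ⊢
  rw [norm_mul, norm_mul, Complex.norm_real, Complex.norm_real,
    Real.norm_of_nonneg (variance_nonneg p), Real.norm_of_nonneg hδ0]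
  calc (p : ℝ) * (1 - p) * δ * _
      ≤ 1 * δ * ((4 * c * y⁻¹ ^ 3 + L * y⁻¹ + 2 * L * y⁻¹ ^ 2) * δ ^ 2) :=
        mul_le_mul (mul_le_mul_of_nonneg_right (variance_le_one p) hδ0) hbound (norm_nonneg _)
          (by positivity)
    _ = _ := by ring

/-- This is the normalized trace of `X R = 1 + i y R`. The squares `R j i ^ 2`, included in each
term for the sake of the expansion, are subtracted again. -/
theorem selfConsistentDefect_eq [Nonempty V] (p : unitInterval) {y : ℝ} (hy : 0 < y)
    (G : SimpleGraph V) :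
    selfConsistentDefect p y G
      = (((√(Fintype.card V))⁻¹ ^ 2 : ℝ) : ℂ) * ∑ i, ∑ j, selfConsistentTerm p y i j G
        - ((p * (1 - p) * (√(Fintype.card V))⁻¹ ^ 4 : ℝ) : ℂ)
          * ∑ i, ∑ j, imResolvent (normalizedAdj p G) y j i ^ 2 := by
  have hc : (((√(Fintype.card V))⁻¹ ^ 2 : ℝ) : ℂ) = (Fintype.card V : ℂ)⁻¹ := by
    rw [inv_pow, Real.sq_sqrt (Nat.cast_nonneg _)]; simp
  have hc0 : (Fintype.card V : ℂ) ≠ 0 := by exact_mod_cast Fintype.card_ne_zero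
  set R := imResolvent (normalizedAdj p G) y with hR
  have h1 : ∑ i, ∑ j, (normalizedAdj p G i j : ℂ) * R j i
      = Fintype.card V + (y : ℂ) * Complex.I * R.trace := by
    have h := congrArg Matrix.trace
      (map_ofReal_mul_imResolvent (normalizedAdj_isHermitian p G) hy)
    rw [Matrix.trace_add, Matrix.trace_one, Matrix.trace_smul, smul_eq_mul, ← hR] at h
    rw [← h]
    simp [Matrix.trace, Matrix.mul_apply]
  have h2 : ∑ i, ∑ j, R i i * R j j = R.trace ^ 2 := by
    rw [sq, Matrix.trace, Finset.sum_mul_sum]; rfl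
  have h3 : ∑ i, ∑ j, selfConsistentTerm p y i j G
      = (Fintype.card V + (y : ℂ) * Complex.I * R.trace)
        + ((p * (1 - p) * (√(Fintype.card V))⁻¹ ^ 2 : ℝ) : ℂ)
          * (∑ i, ∑ j, R j i ^ 2 + R.trace ^ 2) := by
    rw [← h2]
    simp only [selfConsistentTerm, ← hR, Finset.sum_add_distrib, ← Finset.mul_sum, h1]
  have hs : imStieltjes (normalizedAdj p G) y = (Fintype.card V : ℂ)⁻¹ * R.trace := rfl
  have h4 : (((√(Fintype.card V))⁻¹ ^ 4 : ℝ) : ℂ) = (Fintype.card V : ℂ)⁻¹ ^ 2 := by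
    rw [← hc]; push_cast; ring
  rw [selfConsistentDefect, h3, hs, Complex.ofReal_mul (p * (1 - p) : ℝ),
    Complex.ofReal_mul (p * (1 - p) : ℝ), hc, h4]
  field_simp
  ring

/-- The self-consistent equation holds up to an error of order `n ^ (-1/2)` in mean square. -/
theorem graphExp_norm_sq_selfConsistentDefect_le [Nonempty V] (p : unitInterval) {y : ℝ}
    (hy : 0 < y) {c L : ℝ} (hc : c = 2 + y⁻¹ ^ 2) (hL : L = (y + 2 * y⁻¹) * (2 * y⁻¹ ^ 2)) :
    graphExp p (fun G : SimpleGraph V => ‖selfConsistentDefect p y G‖ ^ 2)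
      ≤ (4 * c * y⁻¹ ^ 3 + L * y⁻¹ + 2 * L * y⁻¹ ^ 2 + 3 * c * y⁻¹ ^ 2)
        * (√(Fintype.card V))⁻¹ := by
  have hc0 : 0 ≤ c := by rw [hc]; positivity
  have hL0 : 0 ≤ L := by rw [hL]; positivity
  -- With the conjugate defect as test function, `φ` times the defect is the squared norm.
  set φ : SimpleGraph V → ℂ := fun G => (starRingEnd ℂ) (selfConsistentDefect p y G) with hφdef
  have hφ : ∀ G, ‖φ G‖ ≤ c := fun G => by
    rw [hφdef, RCLike.norm_conj, hc]; exact norm_selfConsistentDefect_le p hy G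
  have hφL : ∀ (i j : V), i ≠ j → ∀ G : SimpleGraph V,
      ‖φ (G ⊔ SimpleGraph.edge i j) - φ (G \ SimpleGraph.edge i j)‖
        ≤ L * (√(Fintype.card V))⁻¹ ^ 3 := fun i j hij G => by
    simp only [hφdef]
    rw [← map_sub, RCLike.norm_conj, hL]
    exact norm_selfConsistentDefect_sup_sub_sdiff_le p G hij hy
  set K : ℝ := 4 * c * y⁻¹ ^ 3 + L * y⁻¹ + 2 * L * y⁻¹ ^ 2 with hK
  have hterm := fun (i j : V) (hij : i ≠ j) =>
    norm_graphExp_mul_selfConsistentTerm_le p hy hij hc0 hL0 hφ (hφL i j hij)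
  set δ : ℝ := (√(Fintype.card V))⁻¹ with hδ
  have hδ0 : 0 ≤ δ := by positivity
  have hδ1 : δ ≤ 1 := by
    refine inv_le_one_of_one_le₀ (Real.one_le_sqrt.2 ?_)
    exact_mod_cast Fintype.card_pos
  have hNδ : (Fintype.card V : ℝ) * δ ^ 2 = 1 := by
    rw [hδ, inv_pow, Real.sq_sqrt (Nat.cast_nonneg _)]
    exact mul_inv_cancel₀ (by exact_mod_cast Fintype.card_ne_zero)
  have hRle : ∀ (G : SimpleGraph V) u v, ‖imResolvent (normalizedAdj p G) y u v‖ ≤ y⁻¹ :=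
    fun G u v => norm_imResolvent_apply_le (normalizedAdj_isHermitian p G) hy u v
  have hdiag : ∀ i : V, ‖graphExp p fun G => φ G * selfConsistentTerm p y i i G‖
      ≤ 2 * c * y⁻¹ ^ 2 * δ ^ 2 := by
    intro i
    refine norm_graphExp_le p fun G => ?_
    have h0 : normalizedAdj p G i i = 0 := by simp [normalizedAdj]
    have h1 : ‖selfConsistentTerm p y i i G‖ ≤ δ ^ 2 * (2 * y⁻¹ ^ 2) := by
      rw [selfConsistentTerm, h0, Complex.ofReal_zero, zero_mul, zero_add, norm_mul,
        Complex.norm_real, Real.norm_of_nonneg (mul_nonneg (variance_nonneg p) (by positivity))]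
      refine mul_le_mul ?_ ?_ (norm_nonneg _) (by positivity)
      · exact mul_le_of_le_one_left (by positivity) (variance_le_one p)
      · rw [← sq]
        refine (norm_add_le _ _).trans ?_
        rw [norm_pow]
        linarith [pow_le_pow_left₀ (norm_nonneg _) (hRle G i i) 2]
    rw [norm_mul]
    calc _ ≤ c * (δ ^ 2 * (2 * y⁻¹ ^ 2)) := mul_le_mul (hφ G) h1 (norm_nonneg _) hc0
      _ = _ := by ring
  have hsq : ∀ G : SimpleGraph V,
      ‖φ G * (((p * (1 - p) * δ ^ 4 : ℝ) : ℂ)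
        * ∑ i, ∑ j, imResolvent (normalizedAdj p G) y j i ^ 2)‖ ≤ c * y⁻¹ ^ 2 * δ ^ 2 := by
    intro G
    have h1 : ‖∑ i, ∑ j, imResolvent (normalizedAdj p G) y j i ^ 2‖
        ≤ Fintype.card V * y⁻¹ ^ 2 := by
      refine le_trans ?_ (sum_norm_sq_imResolvent_le (normalizedAdj_isHermitian p G) hy)
      refine (norm_sum_le _ _).trans (Finset.sum_le_sum fun i _ => ?_)
      refine (norm_sum_le _ _).trans (Finset.sum_le_sum fun j _ => ?_)
      rw [norm_pow]
    rw [norm_mul, norm_mul, Complex.norm_real,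
      Real.norm_of_nonneg (mul_nonneg (variance_nonneg p) (by positivity))]
    calc _ ≤ c * (1 * δ ^ 4 * (Fintype.card V * y⁻¹ ^ 2)) :=
          mul_le_mul (hφ G) (mul_le_mul (mul_le_mul_of_nonneg_right (variance_le_one p)
            (by positivity)) h1 (norm_nonneg _) (by positivity))
            (mul_nonneg (mul_nonneg (variance_nonneg p) (by positivity)) (norm_nonneg _)) hc0
      _ = c * y⁻¹ ^ 2 * δ ^ 2 * (Fintype.card V * δ ^ 2) := by ring
      _ = _ := by rw [hNδ, mul_one]
  have e1 : ((graphExp p fun G : SimpleGraph V => ‖selfConsistentDefect p y G‖ ^ 2 : ℝ) : ℂ)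
      = ((δ ^ 2 : ℝ) : ℂ) * ∑ i, ∑ j, (graphExp p fun G => φ G * selfConsistentTerm p y i j G)
        - graphExp p fun G => φ G * (((p * (1 - p) * δ ^ 4 : ℝ) : ℂ)
        * ∑ i, ∑ j, imResolvent (normalizedAdj p G) y j i ^ 2) := by
    have e2 : ((graphExp p fun G : SimpleGraph V => ‖selfConsistentDefect p y G‖ ^ 2 : ℝ) : ℂ)
        = graphExp p fun G : SimpleGraph V => φ G * selfConsistentDefect p y G := by
      simp only [graphExp, hφdef, Complex.conj_mul', Complex.real_smul, smul_eq_mul]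
      push_cast
      rfl
    simp only [← graphExp_sum]
    rw [e2, ← graphExp_const_mul, ← graphExp_sub]
    congr 1
    ext G
    conv_lhs => rw [selfConsistentDefect_eq p hy G]
    simp only [← Finset.mul_sum]
    ring
  have e3 : ‖∑ i, ∑ j, (graphExp p fun G => φ G * selfConsistentTerm p y i j G)‖
      ≤ Fintype.card V * (Fintype.card V * (K * δ ^ 3) + 2 * c * y⁻¹ ^ 2 * δ ^ 2) := by
    have hi : ∀ i : V, ‖∑ j, (graphExp p fun G => φ G * selfConsistentTerm p y i j G)‖
        ≤ Fintype.card V * (K * δ ^ 3) + 2 * c * y⁻¹ ^ 2 * δ ^ 2 := by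
      intro i
      calc _ ≤ ∑ j, (K * δ ^ 3 + if i = j then 2 * c * y⁻¹ ^ 2 * δ ^ 2 else 0) := by
            refine (norm_sum_le _ _).trans (Finset.sum_le_sum fun j _ => ?_)
            by_cases hij : i = j
            · subst hij
              rw [if_pos rfl]
              have : 0 ≤ K * δ ^ 3 := by positivity
              linarith [hdiag i]
            · rw [if_neg hij, add_zero]
              exact hterm i j hij
        _ = _ := by simp [Finset.sum_add_distrib]
    refine (norm_sum_le _ _).trans ((Finset.sum_le_sum fun i _ => hi i).trans ?_)
    rw [Finset.sum_const, Finset.card_univ, nsmul_eq_mul]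
  have h0 : 0 ≤ graphExp p fun G : SimpleGraph V => ‖selfConsistentDefect p y G‖ ^ 2 :=
    graphExp_nonneg p fun G => sq_nonneg _
  rw [← Real.norm_of_nonneg h0, ← Complex.norm_real, e1]
  refine (norm_sub_le _ _).trans ?_
  have hB := norm_graphExp_le p hsq
  -- As `n δ² = 1`, the `n²` terms of order `δ ^ 3` contribute order `δ`, and the `n` diagonal ones
  -- only order `δ²`.
  have hA : ‖((δ ^ 2 : ℝ) : ℂ)
      * ∑ i, ∑ j, (graphExp p fun G => φ G * selfConsistentTerm p y i j G)‖
      ≤ K * δ + 2 * c * y⁻¹ ^ 2 * δ ^ 2 := by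
    rw [norm_mul, Complex.norm_real, Real.norm_of_nonneg (by positivity)]
    refine (mul_le_mul_of_nonneg_left e3 (by positivity)).trans (le_of_eq ?_)
    linear_combination (K * δ * (Fintype.card V * δ ^ 2 + 1) + 2 * c * y⁻¹ ^ 2 * δ ^ 2) * hNδ
  have hδ2 : δ ^ 2 ≤ δ := by nlinarith
  have := mul_le_mul_of_nonneg_left hδ2 (by positivity : 0 ≤ 3 * c * y⁻¹ ^ 2)
  linarith

end SelfConsistentEquation

/-! ### Coulson integrals for a single eigenvalue and for the semicircle law. -/

section Coulson

open MeasureTheory Set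

theorem hasDerivAt_abs_mul_arctan_div (l y : ℝ) :
    HasDerivAt (fun y => |l| * Real.arctan (y / |l|)) (l ^ 2 / (l ^ 2 + y ^ 2)) y := by
  rcases eq_or_ne l 0 with rfl | hl
  · simpa using hasDerivAt_const y (0 : ℝ)
  · have h0 : |l| ≠ 0 := abs_ne_zero.2 hl
    have h := (((hasDerivAt_id y).div_const |l|).arctan).const_mul |l|
    refine h.congr_deriv ?_
    have h1 : l ^ 2 + y ^ 2 ≠ 0 := by positivity
    have h2 : |l| ^ 2 = l ^ 2 := sq_abs l
    have h3 : |l| ^ 2 + y ^ 2 ≠ 0 := by rwa [h2]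
    simp only [id]
    rw [← h2]
    field_simp

theorem tendsto_abs_mul_arctan_div (l : ℝ) :
    Tendsto (fun y => |l| * Real.arctan (y / |l|)) atTop (𝓝 (|l| * (Real.pi / 2))) := by
  rcases eq_or_ne l 0 with rfl | hl
  · simp
  · refine Tendsto.const_mul _ ?_
    have h := Real.tendsto_arctan_atTop.mono_right (nhdsWithin_le_nhds)
    exact h.comp (tendsto_id.atTop_div_const (abs_pos.2 hl))

theorem integrableOn_sq_div_sq_add_sq (l : ℝ) :
    IntegrableOn (fun y => l ^ 2 / (l ^ 2 + y ^ 2)) (Ioi 0) :=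
  integrableOn_Ioi_deriv_of_nonneg' (fun y _ => hasDerivAt_abs_mul_arctan_div l y)
    (fun y _ => by positivity) (tendsto_abs_mul_arctan_div l)

theorem integral_sq_div_sq_add_sq (l : ℝ) :
    ∫ y in Ioi 0, l ^ 2 / (l ^ 2 + y ^ 2) = |l| * (Real.pi / 2) := by
  have h := integral_Ioi_of_hasDerivAt_of_nonneg' (fun y _ => hasDerivAt_abs_mul_arctan_div l y)
    (fun y (_ : y ∈ Ioi 0) => by positivity) (tendsto_abs_mul_arctan_div l)
  rw [h]; simp

/-- The semicircle law's counterpart of the Coulson integrand: `1 - y h` where `i h` is the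
Stieltjes transform at `i y` of the semicircle law with variance `v`. -/
noncomputable def semicircleCoulson (v y : ℝ) : ℝ := 1 - y * ((√(y ^ 2 + 4 * v) - y) / (2 * v))

theorem semicircleCoulson_eq {v y : ℝ} (hv : 0 < v) :
    semicircleCoulson v y = ((√(y ^ 2 + 4 * v) - y) / (2 * √v)) ^ 2 := by
  have h1 : √(y ^ 2 + 4 * v) ^ 2 = y ^ 2 + 4 * v := Real.sq_sqrt (by positivity)
  have h2 : √v ^ 2 = v := Real.sq_sqrt hv.le
  rw [semicircleCoulson, div_pow, mul_pow, h2]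
  field_simp
  linear_combination -h1

theorem lt_sqrt_sq_add {v y : ℝ} (hv : 0 < v) : |y| < √(y ^ 2 + 4 * v) := by
  rw [← Real.sqrt_sq_eq_abs]
  exact Real.sqrt_lt_sqrt (sq_nonneg y) (by linarith)

/-- Put `t = (√(y² + 4v) - y) / (2√v)`. Then the integrand is `t²` and `y = √v (1/t - t)`, so `t² dy
= -√v (1 + t²) dt`, which integrates to `-√v (t + t³/3)`. As `y` runs from `0` to `∞`, `t` runs from
`1` to `0`, whence the value `4√v / 3`. -/
theorem hasDerivAt_semicircleCoulson_primitive {v : ℝ} (hv : 0 < v) (y : ℝ) :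
    HasDerivAt (fun y => -(√v * ((√(y ^ 2 + 4 * v) - y) / (2 * √v)
      + ((√(y ^ 2 + 4 * v) - y) / (2 * √v)) ^ 3 / 3))) (semicircleCoulson v y) y := by
  have hr : √(y ^ 2 + 4 * v) ^ 2 = y ^ 2 + 4 * v := Real.sq_sqrt (by positivity)
  have hr0 : √(y ^ 2 + 4 * v) ≠ 0 := (Real.sqrt_pos.2 (by positivity)).ne'
  have hs0 : √v ≠ 0 := (Real.sqrt_pos.2 hv).ne'
  have hs : √v ^ 2 = v := Real.sq_sqrt hv.le
  have h1 : HasDerivAt (fun y : ℝ => y ^ 2 + 4 * v) (2 * y) y := by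
    simpa using (hasDerivAt_pow 2 y).add_const (4 * v)
  have h2 := h1.sqrt (by positivity)
  have h3 := (h2.sub (hasDerivAt_id y)).div_const (2 * √v)
  have h4 := ((h3.add ((h3.pow 3).div_const 3)).const_mul (√v)).neg
  refine h4.congr_deriv ?_
  rw [semicircleCoulson_eq hv]
  set r := √(y ^ 2 + 4 * v)
  set s := √v
  have key : (r - y) * (4 * s ^ 2 + (r - y) ^ 2) = 2 * r * (r - y) ^ 2 := by
    rw [hs]; linear_combination -(r - y) * hr
  change -(s * ((2 * y / (2 * r) - 1) / (2 * s) + ((3 : ℕ) : ℝ) * ((r - y) / (2 * s)) ^ (3 - 1)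
    * ((2 * y / (2 * r) - 1) / (2 * s)) / 3)) = ((r - y) / (2 * s)) ^ 2
  calc _ = ((r - y) * (4 * s ^ 2 + (r - y) ^ 2)) / (8 * r * s ^ 2) := by
        norm_num
        field_simp
        ring
    _ = _ := by
        rw [key]
        field_simp
        ring

theorem tendsto_semicircleCoulson_primitive {v : ℝ} (hv : 0 < v) :
    Tendsto (fun y => -(√v * ((√(y ^ 2 + 4 * v) - y) / (2 * √v)
      + ((√(y ^ 2 + 4 * v) - y) / (2 * √v)) ^ 3 / 3))) atTop (𝓝 0) := by
  have h1 : Tendsto (fun y => √(y ^ 2 + 4 * v) - y) atTop (𝓝 0) := by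
    refine squeeze_zero' (g := fun y => 4 * v * y⁻¹) ?_ ?_ ?_
    · exact Eventually.of_forall fun y =>
        sub_nonneg.2 ((le_abs_self y).trans (lt_sqrt_sq_add hv).le)
    · filter_upwards [eventually_gt_atTop 0] with y hy
      have hr : √(y ^ 2 + 4 * v) ^ 2 = y ^ 2 + 4 * v := Real.sq_sqrt (by positivity)
      have hl := (le_abs_self y).trans (lt_sqrt_sq_add (y := y) hv).le
      rw [← div_eq_mul_inv, le_div_iff₀ hy]
      nlinarith
    · simpa using tendsto_inv_atTop_zero.const_mul (4 * v)
  have h2 : Tendsto (fun y => (√(y ^ 2 + 4 * v) - y) / (2 * √v)) atTop (𝓝 0) := by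
    simpa using h1.div_const (2 * √v)
  simpa using ((h2.add ((h2.pow 3).div_const 3)).const_mul (√v)).neg

theorem semicircleCoulson_nonneg {v : ℝ} (hv : 0 < v) (y : ℝ) : 0 ≤ semicircleCoulson v y := by
  rw [semicircleCoulson_eq hv]; positivity

theorem integrableOn_semicircleCoulson {v : ℝ} (hv : 0 < v) :
    IntegrableOn (semicircleCoulson v) (Ioi 0) :=
  integrableOn_Ioi_deriv_of_nonneg' (fun y _ => hasDerivAt_semicircleCoulson_primitive hv y)
    (fun y _ => semicircleCoulson_nonneg hv y) (tendsto_semicircleCoulson_primitive hv)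

theorem integral_semicircleCoulson {v : ℝ} (hv : 0 < v) :
    ∫ y in Ioi 0, semicircleCoulson v y = 4 / 3 * √v := by
  have h := integral_Ioi_of_hasDerivAt_of_nonneg'
    (fun y _ => hasDerivAt_semicircleCoulson_primitive hv y)
    (fun y (_ : y ∈ Ioi 0) => semicircleCoulson_nonneg hv y)
    (tendsto_semicircleCoulson_primitive hv)
  have hs0 : √v ≠ 0 := (Real.sqrt_pos.2 hv).ne'
  have h4 : √(4 * v) = 2 * √v := by
    rw [Real.sqrt_mul (by norm_num), show (4 : ℝ) = 2 ^ 2 by norm_num, Real.sqrt_sq (by norm_num)]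
  rw [h]
  simp only [ne_eq, OfNat.ofNat_ne_zero, not_false_eq_true, zero_pow, zero_add, sub_zero, h4]
  rw [div_self (by positivity)]
  ring

theorem semicircleCoulson_le {v y : ℝ} (hv : 0 < v) (hv1 : v ≤ 1) (hy : 0 < y) :
    semicircleCoulson v y ≤ 2 * (1 + y ^ 2)⁻¹ := by
  have hr : √(y ^ 2 + 4 * v) ^ 2 = y ^ 2 + 4 * v := Real.sq_sqrt (by positivity)
  have hl := (le_abs_self y).trans (lt_sqrt_sq_add (y := y) hv).le
  have h1 : semicircleCoulson v y ≤ 1 := by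
    have : 0 ≤ y * ((√(y ^ 2 + 4 * v) - y) / (2 * v)) :=
      mul_nonneg hy.le (div_nonneg (sub_nonneg.2 hl) (by positivity))
    unfold semicircleCoulson; linarith
  have h2 : semicircleCoulson v y * y ^ 2 ≤ 1 := by
    have hk : (√(y ^ 2 + 4 * v) - y) * y ≤ 2 * v := by nlinarith
    have hk0 : 0 ≤ (√(y ^ 2 + 4 * v) - y) * y := mul_nonneg (sub_nonneg.2 hl) hy.le
    rw [semicircleCoulson_eq hv, div_pow, mul_pow, Real.sq_sqrt hv.le, div_mul_eq_mul_div,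
      div_le_one (by positivity), ← mul_pow]
    nlinarith
  rw [← div_eq_mul_inv, le_div_iff₀ (by positivity)]
  linarith

end Coulson

/-! ### Stability of the quadratic equation. -/

section Stability

/-- Stability of the self-consistent equation on the imaginary axis. -/
theorem abs_one_sub_mul_im_sub_semicircleCoulson_le {v y : ℝ} (hv : 0 < v) (hy : 0 < y) {s : ℂ}
    (hs : 0 ≤ s.im) :
    |1 - y * s.im - semicircleCoulson v y| ≤ ‖1 + (y : ℂ) * Complex.I * s + (v : ℂ) * s ^ 2‖ := by
  have hr : √(y ^ 2 + 4 * v) ^ 2 = y ^ 2 + 4 * v := Real.sq_sqrt (by positivity)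
  have hl := (le_abs_self y).trans (lt_sqrt_sq_add (y := y) hv).le
  set r := √(y ^ 2 + 4 * v) with hrdef
  set h₁ : ℝ := (r - y) / (2 * v) with h₁def
  set h₂ : ℝ := -(r + y) / (2 * v) with h₂def
  have hsum : v * (h₁ + h₂) = -y := by rw [h₁def, h₂def]; field_simp; ring
  have hprod : v * (h₁ * h₂) = -1 := by
    rw [h₁def, h₂def]; field_simp; linear_combination -hr
  have hsum' : (v : ℂ) * (h₁ + h₂) = -y := by exact_mod_cast hsum
  have hprod' : (v : ℂ) * (h₁ * h₂) = -1 := by exact_mod_cast hprod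
  have hfac : 1 + (y : ℂ) * Complex.I * s + (v : ℂ) * s ^ 2
      = (v : ℂ) * (s - h₁ * Complex.I) * (s - h₂ * Complex.I) := by
    linear_combination Complex.I * s * hsum' + hprod' - (v : ℂ) * h₁ * h₂ * Complex.I_sq
  -- The root `i h₂` lies below the real axis and `s` does not, so this factor is bounded below and
  -- can be divided out.
  have h2 : y ≤ v * ‖s - h₂ * Complex.I‖ := by
    have h3 : s.im - h₂ ≤ ‖s - h₂ * Complex.I‖ := by
      refine le_trans (le_of_eq ?_) (Complex.im_le_norm _)
      simp
    have h4 : v * -h₂ = (r + y) / 2 := by rw [h₂def]; field_simp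
    have h5 : v * (s.im - h₂) ≤ v * ‖s - h₂ * Complex.I‖ := mul_le_mul_of_nonneg_left h3 hv.le
    have h6 := mul_nonneg hv.le hs
    linarith
  have h1 : |s.im - h₁| ≤ ‖s - h₁ * Complex.I‖ := by
    refine le_trans (le_of_eq ?_) (Complex.abs_im_le_norm _)
    simp
  have e : 1 - y * s.im - semicircleCoulson v y = -(y * (s.im - h₁)) := by
    rw [semicircleCoulson, ← hrdef, ← h₁def]; ring
  rw [e, abs_neg, abs_mul, abs_of_pos hy, hfac, norm_mul, norm_mul, Complex.norm_real,
    Real.norm_of_nonneg hv.le]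
  calc y * |s.im - h₁| ≤ (v * ‖s - h₂ * Complex.I‖) * ‖s - h₁ * Complex.I‖ :=
        mul_le_mul h2 h1 (abs_nonneg _) (by positivity)
    _ = _ := by ring

end Stability

/-! ### Limit of the normalized energy. -/

section EnergyLimit

open MeasureTheory Set

variable {V : Type*} [Fintype V] [DecidableEq V]

/-- The normalized Coulson integrand of a symmetric matrix. -/
noncomputable def coulsonIntegrand {X : Matrix V V ℝ} (hX : X.IsHermitian) (y : ℝ) : ℝ :=
  (Fintype.card V : ℝ)⁻¹ * ∑ i, hX.eigenvalues i ^ 2 / (hX.eigenvalues i ^ 2 + y ^ 2)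

theorem integrableOn_coulsonIntegrand {X : Matrix V V ℝ} (hX : X.IsHermitian) :
    IntegrableOn (coulsonIntegrand hX) (Ioi 0) :=
  (integrable_finsetSum _ fun i _ => integrableOn_sq_div_sq_add_sq (hX.eigenvalues i)).const_mul _

theorem integral_coulsonIntegrand {X : Matrix V V ℝ} (hX : X.IsHermitian) :
    ∫ y in Ioi 0, coulsonIntegrand hX y
      = (Fintype.card V : ℝ)⁻¹ * (matrixEnergy hX * (Real.pi / 2)) := by
  unfold coulsonIntegrand
  rw [integral_const_mul, integral_finsetSum _ fun i _ =>
    integrableOn_sq_div_sq_add_sq (hX.eigenvalues i)]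
  simp only [integral_sq_div_sq_add_sq, matrixEnergy, Finset.sum_mul]

theorem coulsonIntegrand_nonneg {X : Matrix V V ℝ} (hX : X.IsHermitian) (y : ℝ) :
    0 ≤ coulsonIntegrand hX y :=
  mul_nonneg (by positivity) (Finset.sum_nonneg fun i _ => by positivity)

theorem normalizedAdj_apply_sq_le (p : unitInterval) (G : SimpleGraph V) (i j : V) :
    normalizedAdj p G i j ^ 2 ≤ (Fintype.card V : ℝ)⁻¹ := by
  have h : (√(Fintype.card V : ℝ))⁻¹ ^ 2 = (Fintype.card V : ℝ)⁻¹ := by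
    rw [inv_pow, Real.sq_sqrt (Nat.cast_nonneg _)]
  have hc : 0 ≤ (Fintype.card V : ℝ)⁻¹ := by positivity
  have hp0 := p.2.1
  have hp1 := p.2.2
  simp only [normalizedAdj, Matrix.of_apply]
  split_ifs
  · simp
  · rw [mul_pow, h]
    exact mul_le_of_le_one_right hc (by nlinarith)
  · rw [mul_pow, h]
    exact mul_le_of_le_one_right hc (by nlinarith)

/-- The integrand is at most `1`, and `y²` times it is at most the mean of the squared eigenvalues,
itself at most `1` by the Frobenius norm. The bound is uniform in `n` and `G`, as dominated
convergence requires. -/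
theorem coulsonIntegrand_normalizedAdj_le [Nonempty V] (p : unitInterval) (G : SimpleGraph V)
    {y : ℝ} (hy : 0 < y) :
    coulsonIntegrand (normalizedAdj_isHermitian p G) y ≤ 2 * (1 + y ^ 2)⁻¹ := by
  set hX := normalizedAdj_isHermitian p G
  have hc : (0 : ℝ) < Fintype.card V := by exact_mod_cast Fintype.card_pos
  have h1 : coulsonIntegrand hX y ≤ 1 := by
    unfold coulsonIntegrand
    rw [inv_mul_le_iff₀ hc, mul_one]
    refine (Finset.sum_le_sum (g := fun _ => (1 : ℝ)) fun i _ => ?_).trans (by simp)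
    rw [div_le_one (by positivity)]
    nlinarith
  have h2 : coulsonIntegrand hX y * y ^ 2 ≤ 1 := by
    unfold coulsonIntegrand
    rw [mul_assoc, inv_mul_le_iff₀ hc, mul_one, Finset.sum_mul]
    calc _ ≤ ∑ i, hX.eigenvalues i ^ 2 := by
          refine Finset.sum_le_sum fun i _ => ?_
          rw [div_mul_eq_mul_div, div_le_iff₀ (by positivity)]
          nlinarith [mul_nonneg (sq_nonneg (hX.eigenvalues i)) (sq_nonneg (hX.eigenvalues i))]
      _ = ∑ i, ∑ j, normalizedAdj p G i j ^ 2 := sum_eigenvalues_sq hX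
      _ ≤ ∑ _i : V, ∑ _j : V, (Fintype.card V : ℝ)⁻¹ :=
          Finset.sum_le_sum fun i _ => Finset.sum_le_sum fun j _ => normalizedAdj_apply_sq_le p G i j
      _ = Fintype.card V := by
          simp
  rw [← div_eq_mul_inv, le_div_iff₀ (by positivity)]
  linarith

theorem graphExp_abs_coulsonIntegrand_sub_sq_le [Nonempty V] (p : unitInterval)
    (hp : 0 < (p : ℝ) * (1 - p)) {y : ℝ} (hy : 0 < y) {c L : ℝ} (hc : c = 2 + y⁻¹ ^ 2)
    (hL : L = (y + 2 * y⁻¹) * (2 * y⁻¹ ^ 2)) :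
    graphExp p (fun G : SimpleGraph V => |coulsonIntegrand (normalizedAdj_isHermitian p G) y
        - semicircleCoulson (p * (1 - p)) y|) ^ 2
      ≤ (4 * c * y⁻¹ ^ 3 + L * y⁻¹ + 2 * L * y⁻¹ ^ 2 + 3 * c * y⁻¹ ^ 2)
        * (√(Fintype.card V))⁻¹ := by
  refine (sq_graphExp_le p _).trans (le_trans (graphExp_mono p fun G => ?_)
    (graphExp_norm_sq_selfConsistentDefect_le p hy hc hL))
  refine pow_le_pow_left₀ (abs_nonneg _) ?_ 2
  rw [coulsonIntegrand, ← one_add_re_imStieltjes (normalizedAdj_isHermitian p G) hy]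
  exact abs_one_sub_mul_im_sub_semicircleCoulson_le hp hy
    (imStieltjes_im_nonneg (normalizedAdj_isHermitian p G) hy)

theorem tendsto_graphExp_abs_coulsonIntegrand_sub (p : unitInterval)
    (hp : 0 < (p : ℝ) * (1 - p)) {y : ℝ} (hy : 0 < y) :
    Tendsto (fun n : ℕ => graphExp p (fun G : SimpleGraph (Fin n) =>
      |coulsonIntegrand (normalizedAdj_isHermitian p G) y - semicircleCoulson (p * (1 - p)) y|))
      atTop (𝓝 0) := by
  set c : ℝ := 2 + y⁻¹ ^ 2 with hc
  set L : ℝ := (y + 2 * y⁻¹) * (2 * y⁻¹ ^ 2) with hL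
  have h1 : Tendsto (fun n : ℕ => √((4 * c * y⁻¹ ^ 3 + L * y⁻¹ + 2 * L * y⁻¹ ^ 2
      + 3 * c * y⁻¹ ^ 2) * (√(n : ℝ))⁻¹)) atTop (𝓝 0) := by
    have h2 : Tendsto (fun n : ℕ => (√(n : ℝ))⁻¹) atTop (𝓝 0) :=
      tendsto_inv_atTop_zero.comp (Real.tendsto_sqrt_atTop.comp tendsto_natCast_atTop_atTop)
    have h3 := (h2.const_mul (4 * c * y⁻¹ ^ 3 + L * y⁻¹ + 2 * L * y⁻¹ ^ 2 + 3 * c * y⁻¹ ^ 2)).sqrt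
    simpa using h3
  refine squeeze_zero' (Eventually.of_forall fun n => graphExp_nonneg p fun G => abs_nonneg _) ?_ h1
  filter_upwards [eventually_gt_atTop 0] with n hn
  have : Nonempty (Fin n) := ⟨⟨0, hn⟩⟩
  have h := graphExp_abs_coulsonIntegrand_sub_sq_le (V := Fin n) p hp hy hc hL
  rw [Fintype.card_fin] at h
  exact Real.le_sqrt_of_sq_le h

/-- The energy of the normalized centred adjacency matrix, divided by `n`, converges in mean to
the first absolute moment of the semicircle law. -/
theorem tendsto_graphExp_abs_matrixEnergy_normalizedAdj_sub (p : unitInterval)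
    (hp : 0 < (p : ℝ) * (1 - p)) :
    Tendsto (fun n : ℕ => graphExp p (fun G : SimpleGraph (Fin n) =>
      |(n : ℝ)⁻¹ * matrixEnergy (normalizedAdj_isHermitian p G)
        - 8 / (3 * Real.pi) * √(p * (1 - p))|)) atTop (𝓝 0) := by
  set v : ℝ := p * (1 - p) with hv
  have hmeas : ∀ (n : ℕ) (G : SimpleGraph (Fin n)), IntegrableOn (fun y =>
      |coulsonIntegrand (normalizedAdj_isHermitian p G) y - semicircleCoulson v y|) (Ioi 0) :=
    fun n G => ((integrableOn_coulsonIntegrand _).sub (integrableOn_semicircleCoulson hp)).abs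
  have hint : ∀ n : ℕ, IntegrableOn (fun y => graphExp p (fun G : SimpleGraph (Fin n) =>
      |coulsonIntegrand (normalizedAdj_isHermitian p G) y - semicircleCoulson v y|)) (Ioi 0) := by
    intro n
    exact integrable_finsetSum _ fun G _ => (hmeas n G).smul (graphWeight p G)
  have hlim : Tendsto (fun n : ℕ => ∫ y in Ioi 0, graphExp p (fun G : SimpleGraph (Fin n) =>
      |coulsonIntegrand (normalizedAdj_isHermitian p G) y - semicircleCoulson v y|))
      atTop (𝓝 (∫ _ in Ioi (0 : ℝ), (0 : ℝ))) := by
    refine tendsto_integral_filter_of_dominated_convergence (fun y => 4 * (1 + y ^ 2)⁻¹) ?_ ?_ ?_ ?_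
    · exact Eventually.of_forall fun n => (hint n).aestronglyMeasurable
    · filter_upwards [eventually_gt_atTop 0] with n hn
      have : Nonempty (Fin n) := ⟨⟨0, hn⟩⟩
      refine (ae_restrict_iff' measurableSet_Ioi).2 (Eventually.of_forall fun y hy => ?_)
      refine norm_graphExp_le p fun G => ?_
      have hy : 0 < y := hy
      have h1 := coulsonIntegrand_normalizedAdj_le p G hy
      have h2 := semicircleCoulson_le hp (variance_le_one p) hy
      have h3 := coulsonIntegrand_nonneg (normalizedAdj_isHermitian p G) y
      have h4 := semicircleCoulson_nonneg hp y
      rw [Real.norm_eq_abs, abs_abs, abs_le]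
      constructor <;> linarith
    · exact (integrable_inv_one_add_sq.const_mul 4).integrableOn
    · exact (ae_restrict_iff' measurableSet_Ioi).2 (Eventually.of_forall fun y hy =>
        tendsto_graphExp_abs_coulsonIntegrand_sub p hp hy)
  rw [integral_zero] at hlim
  have hlim2 := hlim.const_mul (2 / Real.pi)
  rw [mul_zero] at hlim2
  refine squeeze_zero (fun n => graphExp_nonneg p fun G => abs_nonneg _) (fun n => ?_) hlim2
  have hswap : ∫ y in Ioi 0, graphExp p (fun G : SimpleGraph (Fin n) =>
      |coulsonIntegrand (normalizedAdj_isHermitian p G) y - semicircleCoulson v y|)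
      = graphExp p (fun G : SimpleGraph (Fin n) => ∫ y in Ioi 0,
      |coulsonIntegrand (normalizedAdj_isHermitian p G) y - semicircleCoulson v y|) := by
    simp only [graphExp, smul_eq_mul]
    rw [integral_finsetSum _ fun G _ => (hmeas n G).const_mul (graphWeight p G)]
    exact Finset.sum_congr rfl fun G _ => integral_const_mul _ _
  rw [hswap, ← graphExp_const_mul]
  refine graphExp_mono p fun G => ?_
  -- The constant is `8 / (3π) = (2 / π) (4 / 3)`, by the two Coulson integrals.
  have h1 : (n : ℝ)⁻¹ * matrixEnergy (normalizedAdj_isHermitian p G) - 8 / (3 * Real.pi) * √v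
      = 2 / Real.pi * ∫ y in Ioi 0,
        (coulsonIntegrand (normalizedAdj_isHermitian p G) y - semicircleCoulson v y) := by
    rw [integral_sub (integrableOn_coulsonIntegrand _) (integrableOn_semicircleCoulson hp),
      integral_coulsonIntegrand, integral_semicircleCoulson hp, Fintype.card_fin]
    have := Real.pi_ne_zero
    field_simp
    ring
  have hpi : 0 ≤ 2 / Real.pi := by positivity
  rw [h1, abs_mul, abs_of_nonneg hpi]
  exact mul_le_mul_of_nonneg_left abs_integral_le_integral_abs hpi

end EnergyLimit

/-! ### From the normalized adjacency matrix to the Harary energy. -/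

section HararyLimit

variable {V : Type*} [Fintype V] [DecidableEq V]

/-- Off the diagonal, distances `1` and `2` give the entry `(1 + a) / 2` with `a` the adjacency
indicator, and `(√n / 2) X` has entry `(a - p) / 2`. -/
theorem hararyMatrix_sub_normalizedAdj [Nonempty V] (p : unitInterval) {G : SimpleGraph V}
    (hG : ∀ i j, i ≠ j → ∃ k, G.Adj i k ∧ G.Adj k j) :
    hararyMatrix G - (√(Fintype.card V : ℝ) / 2) • normalizedAdj p G
      = ((1 + p) / 2 : ℝ) • (Matrix.of (fun _ _ => 1) - 1 : Matrix V V ℝ) := by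
  have hn : √(Fintype.card V : ℝ) ≠ 0 :=
    (Real.sqrt_pos.2 (by exact_mod_cast Fintype.card_pos)).ne'
  ext i j
  by_cases hij : i = j
  · simp [hararyMatrix, normalizedAdj, hij]
  · by_cases hA : G.Adj i j
    · have hd : G.dist i j = 1 := SimpleGraph.dist_eq_one_iff_adj.2 hA
      simp [hararyMatrix, normalizedAdj, hij, hA, hd]
      field_simp
      ring
    · have hd : G.dist i j = 2 := by
        obtain ⟨k, hik, hkj⟩ := hG i j hij
        have h1 : G.dist i j ≤ 2 :=
          SimpleGraph.dist_le (SimpleGraph.Walk.cons hik (SimpleGraph.Walk.cons hkj .nil))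
        have h2 : 0 < G.dist i j := (hik.reachable.trans hkj.reachable).pos_dist_of_ne hij
        have h3 : G.dist i j ≠ 1 := fun h => hA (SimpleGraph.dist_eq_one_iff_adj.1 h)
        omega
      simp [hararyMatrix, normalizedAdj, hij, hA, hd]
      field_simp

theorem abs_hararyEnergy_sub_le [Nonempty V] (p : unitInterval) {G : SimpleGraph V}
    (hG : ∀ i j, i ≠ j → ∃ k, G.Adj i k ∧ G.Adj k j) :
    |hararyEnergy G
        - √(Fintype.card V : ℝ) / 2 * matrixEnergy (normalizedAdj_isHermitian p G)|
      ≤ 2 * Fintype.card V := by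
  refine abs_matrixEnergy_sub_le _ _ (by positivity) fun b => ?_
  rw [hararyMatrix_sub_normalizedAdj p hG]
  refine (sum_abs_quadForm_allOnes_sub_one_le _ b).trans ?_
  have hp0 := p.2.1
  have hp1 := p.2.2
  refine mul_le_mul_of_nonneg_right ?_ (by positivity)
  rw [abs_of_nonneg (by linarith)]
  linarith

/-- A lower bound, in mean, for the probability that the Harary energy is close to its limit. -/
theorem one_sub_le_binomialRandom_real (p : unitInterval) {n : ℕ} (hn : 0 < n) {ε : ℝ}
    (hε : 0 < ε) (hnε : 2 * (n : ℝ) ≤ ε / 2 * (n : ℝ) ^ (3 / 2 : ℝ)) :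
    1 - (n : ℝ) ^ 2 * (1 - (p : ℝ) ^ 2) ^ (n - 2)
        - ε⁻¹ * graphExp p (fun G : SimpleGraph (Fin n) =>
          |(n : ℝ)⁻¹ * matrixEnergy (normalizedAdj_isHermitian p G)
            - 8 / (3 * Real.pi) * √(p * (1 - p))|)
      ≤ (SimpleGraph.binomialRandom (Fin n) p).real
          {G : SimpleGraph (Fin n) |
            |hararyEnergy G
                - 4 / (3 * Real.pi) * Real.sqrt ((p : ℝ) * (1 - (p : ℝ))) * (n : ℝ) ^ (3 / 2 : ℝ)|
              ≤ ε * (n : ℝ) ^ (3 / 2 : ℝ)} := by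
  classical
  have : Nonempty (Fin n) := ⟨⟨0, hn⟩⟩
  have hn0 : (0 : ℝ) < n := by exact_mod_cast hn
  have hpow : (n : ℝ) ^ (3 / 2 : ℝ) = √n * n := by
    rw [show (3 / 2 : ℝ) = 1 / 2 + 1 by norm_num, Real.rpow_add hn0, Real.rpow_one,
      Real.sqrt_eq_rpow]
  rw [binomialRandom_real_apply]
  have hone : graphExp p (fun _ : SimpleGraph (Fin n) => (1 : ℝ)) = 1 := by
    simp [graphExp, sum_graphWeight]
  set bad : Fin n × Fin n → SimpleGraph (Fin n) → ℝ := fun e G =>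
    if ∀ k ∈ Finset.univ \ {e.1, e.2}, ¬ (G.Adj e.1 k ∧ G.Adj k e.2) then (1 : ℝ) else 0 with hbad
  have hbad0 : ∀ e G, 0 ≤ bad e G := fun e G => by
    simp only [hbad]; split_ifs <;> norm_num
  have hp1 : 0 ≤ 1 - (p : ℝ) ^ 2 := by nlinarith [p.2.1, p.2.2]
  have hbadE : ∑ e ∈ (Finset.univ : Finset (Fin n)).offDiag, graphExp p (bad e)
      ≤ (n : ℝ) ^ 2 * (1 - (p : ℝ) ^ 2) ^ (n - 2) := by
    have h1 : ∀ e ∈ (Finset.univ : Finset (Fin n)).offDiag,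
        graphExp p (bad e) = (1 - (p : ℝ) ^ 2) ^ (n - 2) := by
      intro e he
      have hne : e.1 ≠ e.2 := by simpa using he
      have h := graphExp_no_common_neighbor p hne (Finset.univ \ {e.1, e.2}) (by simp) (by simp)
      rw [Finset.card_sdiff_of_subset (by simp), Finset.card_pair hne, Finset.card_univ,
        Fintype.card_fin] at h
      rw [← h, hbad]
      congr!
    rw [Finset.sum_congr rfl h1, Finset.sum_const, nsmul_eq_mul]
    refine mul_le_mul_of_nonneg_right ?_ (pow_nonneg hp1 _)
    rw [Finset.offDiag_card, Finset.card_univ, Fintype.card_fin, sq]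
    exact_mod_cast Nat.sub_le _ _
  -- Union bound and Markov's inequality at once: if the left side is positive, no pair is bad and
  -- `|d| < ε`, which forces the event.
  have hpt : ∀ G : SimpleGraph (Fin n),
      (1 - ∑ e ∈ (Finset.univ : Finset (Fin n)).offDiag, bad e G)
        - ε⁻¹ * |(n : ℝ)⁻¹ * matrixEnergy (normalizedAdj_isHermitian p G)
            - 8 / (3 * Real.pi) * √(p * (1 - p))|
      ≤ if G ∈ {G : SimpleGraph (Fin n) |
            |hararyEnergy G
                - 4 / (3 * Real.pi) * Real.sqrt ((p : ℝ) * (1 - (p : ℝ))) * (n : ℝ) ^ (3 / 2 : ℝ)|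
              ≤ ε * (n : ℝ) ^ (3 / 2 : ℝ)} then (1 : ℝ) else 0 := by
    intro G
    set d : ℝ := (n : ℝ)⁻¹ * matrixEnergy (normalizedAdj_isHermitian p G)
            - 8 / (3 * Real.pi) * √(p * (1 - p)) with hd
    have hsum0 : 0 ≤ ∑ e ∈ (Finset.univ : Finset (Fin n)).offDiag, bad e G :=
      Finset.sum_nonneg fun e _ => hbad0 e G
    have hd0 : 0 ≤ ε⁻¹ * |d| := by positivity
    split_ifs with hmem
    · linarith
    · by_contra! hcon
      have hdε : |d| < ε := by
        have : ε⁻¹ * |d| < 1 := by linarith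
        rwa [inv_mul_lt_iff₀ hε, mul_one] at this
      have hG : ∀ i j, i ≠ j → ∃ k, G.Adj i k ∧ G.Adj k j := by
        intro i j hij
        by_contra! hno
        have h1 : bad (i, j) G = 1 := by
          simp only [hbad]
          exact if_pos fun k _ h => hno k h.1 h.2
        have h2 := Finset.single_le_sum (f := fun e => bad e G) (fun e _ => hbad0 e G)
          (show (i, j) ∈ (Finset.univ : Finset (Fin n)).offDiag by simpa using hij)
        simp only [h1] at h2
        linarith
      apply hmem
      have h1 := abs_hararyEnergy_sub_le p hG
      rw [Fintype.card_fin] at h1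
      -- Half of the tolerance `ε n ^ (3/2)` goes to `d`, the other half to the perturbation error
      -- `2 n`, by `hnε`.
      have h2 : √(n : ℝ) / 2 * matrixEnergy (normalizedAdj_isHermitian p G)
          - 4 / (3 * Real.pi) * √((p : ℝ) * (1 - p)) * (n : ℝ) ^ (3 / 2 : ℝ)
          = (n : ℝ) ^ (3 / 2 : ℝ) / 2 * d := by
        have := Real.pi_ne_zero
        rw [hd, hpow]
        field_simp
        ring
      have hP : 0 ≤ (n : ℝ) ^ (3 / 2 : ℝ) := by positivity
      have h3 : |(n : ℝ) ^ (3 / 2 : ℝ) / 2 * d| ≤ (n : ℝ) ^ (3 / 2 : ℝ) / 2 * ε := by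
        rw [abs_mul, abs_of_nonneg (by positivity)]
        exact mul_le_mul_of_nonneg_left hdε.le (by positivity)
      rw [← h2] at h3
      have h4 := abs_sub_le (hararyEnergy G)
        (√(n : ℝ) / 2 * matrixEnergy (normalizedAdj_isHermitian p G))
        (4 / (3 * Real.pi) * √((p : ℝ) * (1 - p)) * (n : ℝ) ^ (3 / 2 : ℝ))
      simp only [Set.mem_ofPred_eq]
      linarith
  refine le_trans ?_ (graphExp_mono p hpt)
  rw [graphExp_sub, graphExp_sub, graphExp_const_mul, graphExp_sum, hone]
  linarith

end HararyLimit

theorem corollary3p2 (p : unitInterval) (hp0 : 0 < (p : ℝ)) (hp1 : (p : ℝ) < 1) :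
    ∀ ε : ℝ, 0 < ε →
      Tendsto
        (fun n : ℕ => SimpleGraph.binomialRandom (Fin n) p
          {G : SimpleGraph (Fin n) |
            |hararyEnergy G
                - 4 / (3 * Real.pi) * Real.sqrt ((p : ℝ) * (1 - (p : ℝ))) * (n : ℝ) ^ (3 / 2 : ℝ)|
              ≤ ε * (n : ℝ) ^ (3 / 2 : ℝ)})
        atTop (𝓝 1) := by
  intro ε hε
  have hv : 0 < (p : ℝ) * (1 - p) := mul_pos hp0 (sub_pos.2 hp1)
  have hgeom : Tendsto (fun n : ℕ => (n : ℝ) ^ 2 * (1 - (p : ℝ) ^ 2) ^ (n - 2)) atTop (𝓝 0) := by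
    set q : ℝ := 1 - (p : ℝ) ^ 2 with hq
    have hq0 : 0 < q := by rw [hq]; nlinarith
    have hq1 : q < 1 := by rw [hq]; nlinarith
    have h := (tendsto_pow_const_mul_const_pow_of_abs_lt_one 2
      (r := q) (by rw [abs_of_pos hq0]; exact hq1)).mul_const (q ^ 2)⁻¹
    rw [zero_mul] at h
    refine h.congr' ?_
    -- Natural subtraction truncates, so `q ^ (n - 2)` is `q ^ n / q ^ 2` only from `n = 2` on.
    filter_upwards [eventually_ge_atTop 2] with n hn
    rw [pow_sub₀ _ hq0.ne' hn]
    ring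
  have hlow := ((tendsto_const_nhds (x := (1 : ℝ))).sub hgeom).sub
    ((tendsto_graphExp_abs_matrixEnergy_normalizedAdj_sub p hv).const_mul ε⁻¹)
  rw [sub_zero, mul_zero, sub_zero] at hlow
  have hlarge : ∀ᶠ n : ℕ in atTop, 2 * (n : ℝ) ≤ ε / 2 * (n : ℝ) ^ (3 / 2 : ℝ) := by
    have h1 : Tendsto (fun n : ℕ => √(n : ℝ)) atTop atTop :=
      Real.tendsto_sqrt_atTop.comp tendsto_natCast_atTop_atTop
    filter_upwards [h1.eventually_ge_atTop (4 / ε), eventually_gt_atTop 0] with n hn h0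
    have hn0 : (0 : ℝ) < n := by exact_mod_cast h0
    rw [show (3 / 2 : ℝ) = 1 / 2 + 1 by norm_num, Real.rpow_add hn0, Real.rpow_one,
      ← Real.sqrt_eq_rpow, ← mul_assoc]
    refine mul_le_mul_of_nonneg_right ?_ hn0.le
    rw [div_le_iff₀ hε] at hn
    linarith
  have hreal := tendsto_of_tendsto_of_tendsto_of_le_of_le' hlow
    (tendsto_const_nhds (x := (1 : ℝ)))
    ((eventually_gt_atTop 0).and hlarge |>.mono fun n hn =>
      one_sub_le_binomialRandom_real p hn.1 hε hn.2)
    (Eventually.of_forall fun n => MeasureTheory.measureReal_le_one)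
  have henn := ENNReal.tendsto_ofReal hreal
  rw [ENNReal.ofReal_one] at henn
  refine henn.congr fun n => ?_
  exact MeasureTheory.ofReal_measureReal
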